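/- For $k\in\mathbb Z_{\ge 0}\cup\{\infty\}$ write $(a;q)_k=\prod_{0\le j<k}(1-aq^j)$, and let \[ G(q)=\sum_{k=0}^\infty\frac{q^{k^2}}{(q;q)_k},\qquad H(q)=\sum_{k=0}^\infty\frac{q^{k(k+1)}}{(q;q)_k},\qquad F(q)=\prod_{j=0}^\infty\frac{1-q^{8j+8}}{1-q^{2j+2}}, \] \[ \tilde G(q)=\prod_{j=0}^\infty\frac1{(1-q^{5j+1})(1-q^{5j+4})},\qquad \tilde H(q)=\prod_{j=0}^\infty\frac1{(1-q^{5j+2})(1-q^{5j+3})}. \] Let either $q$ be a complex number with $|q|<1$, or let $q$ be the indeterminate of the ring $R[[q]]$ of formal power series over a commutative ring $R$ with a Hausdorff topology (for instance the discrete one), where sums and products converge in the topology of coefficientwise convergence. Then all these sums and products, as well as $(q^n;q^5)_\infty$ for $n\ge1$, converge, the elements $1-q^n$ and $(q^n;q^5)_\infty$ with $n\ge 1$ are invertible, and the Rogers–Ramanujan identities hold: \[ G(q)=\tilde G(q)=\frac1{(q;q^5)_\infty(q^4;q^5)_\infty},\qquad H(q)=\tilde H(q)=\frac1{(q^2;q^5)_\infty(q^3;q^5)_\infty}.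 \] Moreover, both the pair $(G,H)$ and the pair $(\tilde G,\tilde H)$ take the value $(1,1)$ at $q=0$ and satisfy Rogers' functional equations \[ G(q)=F(q)\bigl(G(q^{16})+qH(-q^4)\bigr),\qquad H(q)=F(q)\bigl(G(-q^4)+q^3H(q^{16})\bigr), \] and any two pairs of formal power series in $R[[q]]$ that satisfy these functional equations and have constant terms $(1,1)$ are equal. -/

import Mathlib

open scoped PowerSeries.WithPiTopology

/-! The definitions below make sense at an element `q` of a commutative ring `A` with a topology.
They are used for a complex number `q` (where `Ring.inverse x = x⁻¹`), and for the
indeterminate `X` of the ring `R⟦X⟧` of formal power series. `Ring.inverse x` is the inverse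
of `x` whenever `x` is a unit. -/

/-- The finite `q`-Pochhammer symbol `(a;q)_k = ∏_{j=0}^{k-1} (1 - a q^j)`. -/
def qPochhammer {A : Type*} [CommRing A] (a q : A) (k : ℕ) : A :=
  ∏ j ∈ Finset.range k, (1 - a * q ^ j)

/-- The infinite `q`-Pochhammer symbol `(a;q)_∞ = ∏_{j=0}^∞ (1 - a q^j)`. -/
noncomputable def qPochhammerInf {A : Type*} [CommRing A] [TopologicalSpace A] (a q : A) : A :=
  ∏' j : ℕ, (1 - a * q ^ j)

namespace RogersRamanujan

/-- The term `q^{k²} / (q;q)_k`. -/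
noncomputable def sumTermG {A : Type*} [CommRing A] (q : A) (k : ℕ) : A :=
  q ^ (k ^ 2) * Ring.inverse (qPochhammer q q k)

/-- The term `q^{k(k+1)} / (q;q)_k`. -/
noncomputable def sumTermH {A : Type*} [CommRing A] (q : A) (k : ℕ) : A :=
  q ^ (k * (k + 1)) * Ring.inverse (qPochhammer q q k)

/-- The factor `1 / ((1 - q^{5j+1}) (1 - q^{5j+4}))`. -/
noncomputable def prodFactorG {A : Type*} [CommRing A] (q : A) (j : ℕ) : A :=
  Ring.inverse ((1 - q ^ (5 * j + 1)) * (1 - q ^ (5 * j + 4)))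

/-- The factor `1 / ((1 - q^{5j+2}) (1 - q^{5j+3}))`. -/
noncomputable def prodFactorH {A : Type*} [CommRing A] (q : A) (j : ℕ) : A :=
  Ring.inverse ((1 - q ^ (5 * j + 2)) * (1 - q ^ (5 * j + 3)))

/-- The factor `(1 - q^{8j+8}) / (1 - q^{2j+2})`. -/
noncomputable def factorF {A : Type*} [CommRing A] (q : A) (j : ℕ) : A :=
  (1 - q ^ (8 * j + 8)) * Ring.inverse (1 - q ^ (2 * j + 2))

/-- The sum side `G(q) = ∑_{k ≥ 0} q^{k²} / (q;q)_k`. -/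
noncomputable def sumG {A : Type*} [CommRing A] [TopologicalSpace A] (q : A) : A :=
  ∑' k : ℕ, sumTermG q k

/-- The sum side `H(q) = ∑_{k ≥ 0} q^{k(k+1)} / (q;q)_k`. -/
noncomputable def sumH {A : Type*} [CommRing A] [TopologicalSpace A] (q : A) : A :=
  ∑' k : ℕ, sumTermH q k

/-- The product side `∏_{j ≥ 0} 1 / ((1 - q^{5j+1}) (1 - q^{5j+4}))`. -/
noncomputable def prodG {A : Type*} [CommRing A] [TopologicalSpace A] (q : A) : A :=
  ∏' j : ℕ, prodFactorG q j

/-- The product side `∏_{j ≥ 0} 1 / ((1 - q^{5j+2}) (1 - q^{5j+3}))`. -/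
noncomputable def prodH {A : Type*} [CommRing A] [TopologicalSpace A] (q : A) : A :=
  ∏' j : ℕ, prodFactorH q j

/-- `F(q) = ∏_{j ≥ 0} (1 - q^{8j+8}) / (1 - q^{2j+2})`. -/
noncomputable def F {A : Type*} [CommRing A] [TopologicalSpace A] (q : A) : A :=
  ∏' j : ℕ, factorF q j

/-- Every infinite sum and product that occurs in the identities converges at `q`, and the
denominators are invertible. -/
def Converges {A : Type*} [CommRing A] [TopologicalSpace A] (q : A) : Prop :=
  (∀ n : ℕ, 0 < n → IsUnit (1 - q ^ n)) ∧
  Summable (sumTermG q) ∧ Summable (sumTermH q) ∧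
  Multipliable (prodFactorG q) ∧ Multipliable (prodFactorH q) ∧ Multipliable (factorF q) ∧
  (∀ n : ℕ, 0 < n → Multipliable (fun j : ℕ => 1 - q ^ n * (q ^ 5) ^ j) ∧
    IsUnit (qPochhammerInf (q ^ n) (q ^ 5)))

/-- Rogers' equations at the complex number `q`, for two functions `G` and `H`. -/
def RogersEquationsAt (G H : ℂ → ℂ) (q : ℂ) : Prop :=
  G q = F q * (G (q ^ 16) + q * H (-q ^ 4)) ∧
  H q = F q * (G (-q ^ 4) + q ^ 3 * H (q ^ 16))

/-- Rogers' equations for two formal power series `G` and `H` in the indeterminate `q = X`. -/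
def RogersEquations {R : Type*} [CommRing R] [TopologicalSpace R] (G H : PowerSeries R) : Prop :=
  G = F (PowerSeries.X : PowerSeries R) *
    (PowerSeries.subst (PowerSeries.X ^ 16 : PowerSeries R) G +
      PowerSeries.X * PowerSeries.subst (-PowerSeries.X ^ 4 : PowerSeries R) H) ∧
  H = F (PowerSeries.X : PowerSeries R) *
    (PowerSeries.subst (-PowerSeries.X ^ 4 : PowerSeries R) G +
      PowerSeries.X ^ 3 * PowerSeries.subst (PowerSeries.X ^ 16 : PowerSeries R) H)

end RogersRamanujan

/-! Everything is first proved at an element `q` with `‖q‖ < 1` of a complete normed commutative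
ring with `‖1‖ = 1`. This covers `ℂ` and also `ℤ⟦X⟧` with the norm `2^{-order}` (`IntSeries`). The
formal statements over `R` follow by applying continuous ring homomorphisms to the identities at
`IntSeries.X`: base change to `R⟦X⟧`, substitution, and the constant coefficient.

The Rogers–Ramanujan identities come from a Bailey pair. By `baileySum_zero` and `baileySum_one`,
`1/(q;q)_n` is the sum over `j` of `(-1)^j q^{(3j²+j)/2} / ((q;q)_{n-j} (q;q)_{n+c+j})` for `c = 0,
1`. Inserting this in the sum sides and exchanging the summations leaves inner sums over `n` that
Cauchy's series (`tsum_cauchyTerm`) evaluates. The result is a theta series divided by `(q;q)_∞`;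
Jacobi's triple product (`hasSum_thetaTerm`) and the splitting of `(q;q)_∞` modulo 5 give the
products.

Rogers' equations for the sums have an independent proof. By `tsum_sq_mul_recip`, `G(q) = (-q²;q²)_∞
∑ q^{n²}/(q⁴;q⁴)_n`, and `tsum_sq_add_mul_recip` is the analogue for `H` with `q^{n²+2n}`. The even
and odd parts of these series, multiplied by `(q⁴;q⁸)_∞`, are again values of `G` and `H`, and `F(q)
(q⁴;q⁸)_∞ = (-q²;q²)_∞` by `F_mul`. All evaluations expand an infinite product by Euler and collapse
finite `q`-binomial sums. The products inherit the equations from the sums. Uniqueness holds because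
the substitutions strictly raise the order of a difference without constant term. -/

namespace RogersRamanujan
open Filter Topology

set_option linter.unusedSectionVars false

/-! ### Infinite products in complete normed rings and Euler's expansion -/

section Basic

variable {A : Type*} [NormedCommRing A] [NormOneClass A] [CompleteSpace A]

lemma norm_pow_lt_one {q : A} (hq : ‖q‖ < 1) {n : ℕ} (hn : n ≠ 0) : ‖q ^ n‖ < 1 :=
  (norm_pow_le q n).trans_lt (pow_lt_one₀ (norm_nonneg q) hq hn)

lemma norm_mul_lt_one {a b : A} (ha : ‖a‖ < 1) (hb : ‖b‖ ≤ 1) : ‖a * b‖ < 1 :=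
  (norm_mul_le a b).trans_lt ((mul_le_of_le_one_right (norm_nonneg a) hb).trans_lt ha)

lemma norm_pow_le_one {q : A} (hq : ‖q‖ < 1) (n : ℕ) : ‖q ^ n‖ ≤ 1 :=
  (norm_pow_le q n).trans (pow_le_one₀ (norm_nonneg q) hq.le)

lemma norm_pow_le_of_le {q : A} (hq : ‖q‖ < 1) {m n : ℕ} (h : m ≤ n) : ‖q ^ n‖ ≤ ‖q‖ ^ m :=
  (norm_pow_le q n).trans (pow_le_pow_of_le_one (norm_nonneg q) hq.le h)

lemma norm_inverse_one_sub_le {t : A} (ht : ‖t‖ < 1) :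
    ‖Ring.inverse (1 - t)‖ ≤ (1 - ‖t‖)⁻¹ := by
  rw [← geom_series_eq_inverse t ht]
  simpa using tsum_geometric_le_of_norm_lt_one t ht

lemma inverse_one_sub_eq {t : A} (ht : ‖t‖ < 1) :
    Ring.inverse (1 - t) = 1 + t * Ring.inverse (1 - t) := by
  have := Ring.mul_inverse_cancel _ (isUnit_one_sub_of_norm_lt_one ht)
  linear_combination this

lemma multipliable_one_sub {t : ℕ → A} (ht : Summable fun j => ‖t j‖) :
    Multipliable fun j => 1 - t j := by
  simpa [sub_eq_add_neg] using multipliable_one_add_of_summable (f := fun j => -t j) (by simpa)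

lemma multipliable_inverse_one_sub {t : ℕ → A} (ht : Summable fun j => ‖t j‖)
    (h1 : ∀ j, ‖t j‖ < 1) : Multipliable fun j => Ring.inverse (1 - t j) := by
  have : Summable fun j => ‖t j * Ring.inverse (1 - t j)‖ := by
    -- The factor 2 bounds `1 / (1 - ‖t j‖)` as soon as `‖t j‖ ≤ 1/2`.
    refine Summable.of_norm_bounded_eventually_nat (ht.mul_right 2) ?_
    have := ht.tendsto_atTop_zero.eventually (ge_mem_nhds (show (0 : ℝ) < 1 / 2 by norm_num))
    filter_upwards [this] with j hj
    rw [norm_norm]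
    refine (norm_mul_le _ _).trans (mul_le_mul_of_nonneg_left ?_ (norm_nonneg _))
    refine (norm_inverse_one_sub_le (h1 j)).trans ?_
    rw [inv_le_comm₀ (by linarith) (by norm_num)]
    linarith
  refine (multipliable_one_add_of_summable this).congr fun j => ?_
  exact (inverse_one_sub_eq (h1 j)).symm

lemma isUnit_tprod_one_sub {t : ℕ → A} (ht : Summable fun j => ‖t j‖)
    (h1 : ∀ j, ‖t j‖ < 1) : IsUnit (∏' j, (1 - t j)) := by
  have h := (multipliable_one_sub ht).hasProd.mul (multipliable_inverse_one_sub ht h1).hasProd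
  refine IsUnit.of_mul_eq_one _ (h.unique ?_)
  simp only [fun j => Ring.mul_inverse_cancel _ (isUnit_one_sub_of_norm_lt_one (h1 j))]
  exact hasProd_one

lemma summable_norm_mul_pow {q : A} (hq : ‖q‖ < 1) (a : A) :
    Summable fun j : ℕ => ‖a * q ^ j‖ :=
  ((summable_geometric_of_lt_one (norm_nonneg q) hq).mul_left ‖a‖).of_nonneg_of_le
    (fun _ => norm_nonneg _) fun j => (norm_mul_le _ _).trans
      (mul_le_mul_of_nonneg_left (norm_pow_le q j) (norm_nonneg a))

lemma multipliable_qPochhammer {q : A} (hq : ‖q‖ < 1) (a : A) :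
    Multipliable fun j : ℕ => 1 - a * q ^ j :=
  multipliable_one_sub (summable_norm_mul_pow hq a)

lemma isUnit_qPochhammerInf {a q : A} (ha : ‖a‖ < 1) (hq : ‖q‖ < 1) :
    IsUnit (qPochhammerInf a q) :=
  isUnit_tprod_one_sub (summable_norm_mul_pow hq a)
    fun j => norm_mul_lt_one ha (norm_pow_le_one hq j)

lemma tendsto_qPochhammer {q : A} (hq : ‖q‖ < 1) (a : A) :
    Tendsto (qPochhammer a q) atTop (𝓝 (qPochhammerInf a q)) :=
  (multipliable_qPochhammer hq a).hasProd.tendsto_prod_nat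

lemma qPochhammer_zero {R : Type*} [CommRing R] (a q : R) : qPochhammer a q 0 = 1 := by
  simp [qPochhammer]

lemma qPochhammer_succ {R : Type*} [CommRing R] (a q : R) (n : ℕ) :
    qPochhammer a q (n + 1) = qPochhammer a q n * (1 - a * q ^ n) := by
  simp [qPochhammer, Finset.prod_range_succ]

lemma qPochhammer_self_succ {R : Type*} [CommRing R] (q : R) (n : ℕ) :
    qPochhammer q q (n + 1) = qPochhammer q q n * (1 - q ^ (n + 1)) := by
  rw [qPochhammer_succ, pow_succ']

lemma qPochhammer_succ_left {R : Type*} [CommRing R] (a q : R) (n : ℕ) :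
    qPochhammer a q (n + 1) = (1 - a) * qPochhammer (a * q) q n := by
  simp [qPochhammer, Finset.prod_range_succ', pow_succ', mul_assoc, mul_comm]

lemma isUnit_qPochhammer {a q : A} (ha : ‖a‖ < 1) (hq : ‖q‖ < 1) (n : ℕ) :
    IsUnit (qPochhammer a q n) := by
  induction n with
  | zero => simp [qPochhammer_zero]
  | succ n ih =>
    rw [qPochhammer_succ]
    exact ih.mul (isUnit_one_sub_of_norm_lt_one (norm_mul_lt_one ha (norm_pow_le_one hq n)))

lemma qPochhammerInf_eq_one_sub_mul {q : A} (hq : ‖q‖ < 1) (a : A) :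
    qPochhammerInf a q = (1 - a) * qPochhammerInf (a * q) q := by
  refine tendsto_nhds_unique ((tendsto_add_atTop_iff_nat 1).2 (tendsto_qPochhammer hq a)) ?_
  simp only [qPochhammer_succ_left]
  exact (tendsto_qPochhammer hq (a * q)).const_mul _

lemma qPochhammerInf_eq_qPochhammer_mul {q : A} (hq : ‖q‖ < 1) (a : A) (n : ℕ) :
    qPochhammerInf a q = qPochhammer a q n * qPochhammerInf (a * q ^ n) q := by
  induction n with
  | zero => simp [qPochhammer_zero]
  | succ n ih =>
    rw [ih, qPochhammerInf_eq_one_sub_mul hq (a * q ^ n), qPochhammer_succ]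
    ring_nf

/-- The reciprocal `1 / (q;q)_n`. -/
noncomputable def recip {A : Type*} [CommRing A] (q : A) (n : ℕ) : A :=
  Ring.inverse (qPochhammer q q n)

lemma recip_zero (q : A) : recip q 0 = 1 := by simp [recip, qPochhammer_zero]

lemma qPochhammer_mul_recip {q : A} (hq : ‖q‖ < 1) (n : ℕ) :
    qPochhammer q q n * recip q n = 1 :=
  Ring.mul_inverse_cancel _ (isUnit_qPochhammer hq hq n)

lemma recip_eq {q : A} (hq : ‖q‖ < 1) (n : ℕ) :
    recip q n = (1 - q ^ (n + 1)) * recip q (n + 1) := by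
  have h1 := qPochhammer_mul_recip hq n
  have h2 := qPochhammer_mul_recip hq (n + 1)
  rw [qPochhammer_self_succ] at h2
  linear_combination (-recip q n) * h2 + (1 - q ^ (n + 1)) * recip q (n + 1) * h1

lemma tendsto_recip {q : A} (hq : ‖q‖ < 1) :
    Tendsto (recip q) atTop (𝓝 (Ring.inverse (qPochhammerInf q q))) := by
  have hu := isUnit_qPochhammerInf hq hq
  have := NormedRing.inverse_continuousAt hu.unit
  exact this.tendsto.comp (tendsto_qPochhammer hq q)

lemma exists_norm_recip_le {q : A} (hq : ‖q‖ < 1) : ∃ C : ℝ, 0 ≤ C ∧ ∀ n, ‖recip q n‖ ≤ C := by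
  obtain ⟨C, hC⟩ := (tendsto_recip hq).norm.bddAbove_range
  exact ⟨C, (norm_nonneg _).trans (hC ⟨0, rfl⟩), fun n => hC ⟨n, rfl⟩⟩

lemma sq_eq_two_mul_choose_two_add (k : ℕ) : k ^ 2 = 2 * k.choose 2 + k := by
  induction k with
  | zero => simp
  | succ k ih =>
    have : (k + 1).choose 2 = k + k.choose 2 := by
      rw [Nat.choose_succ_succ' k 1, Nat.choose_one_right]
    rw [this]; nlinarith

lemma choose_two_succ (k : ℕ) : (k + 1).choose 2 = k + k.choose 2 := by
  rw [Nat.choose_succ_succ' k 1, Nat.choose_one_right]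

/-- The term of Euler's expansion of `(-c;q)_∞`. -/
noncomputable def eulerTerm {A : Type*} [CommRing A] (q c : A) (k : ℕ) : A :=
  c ^ k * q ^ k.choose 2 * recip q k

lemma norm_eulerTerm_le {q : A} (hq : ‖q‖ < 1) {C : ℝ} (hC : ∀ n, ‖recip q n‖ ≤ C) (c : A)
    (k : ℕ) : ‖eulerTerm q c k‖ ≤ ‖c‖ ^ k * C := by
  refine (norm_mul_le _ _).trans (mul_le_mul ?_ (hC k) (norm_nonneg _) (by positivity))
  exact (norm_mul_le _ _).trans ((mul_le_of_le_one_right (norm_nonneg _)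
    (norm_pow_le_one hq _)).trans (norm_pow_le c k))

lemma summable_norm_eulerTerm {q : A} (hq : ‖q‖ < 1) {c : A} (hc : ‖c‖ < 1) :
    Summable fun k => ‖eulerTerm q c k‖ := by
  obtain ⟨C, -, hC⟩ := exists_norm_recip_le hq
  exact ((summable_geometric_of_lt_one (norm_nonneg c) hc).mul_right C).of_nonneg_of_le
    (fun _ => norm_nonneg _) (norm_eulerTerm_le hq hC c)

/-- The series counterpart of splitting the first factor off `(-c;q)_∞`. In the difference of the
terms at `c` and `c q` a factor `1 - q^k` appears and cancels the last factor of `(q;q)_k`, which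
shifts the index by one. -/
lemma tsum_eulerTerm_eq {q : A} (hq : ‖q‖ < 1) {c : A} (hc : ‖c‖ < 1) :
    ∑' k, eulerTerm q c k = (1 + c) * ∑' k, eulerTerm q (c * q) k := by
  have h1 := (summable_norm_eulerTerm hq hc).of_norm
  have h2 := (summable_norm_eulerTerm hq (norm_mul_lt_one hc hq.le)).of_norm
  have h3 : ∑' k, (eulerTerm q c k - eulerTerm q (c * q) k) =
      c * ∑' k, eulerTerm q (c * q) k := by
    rw [(h1.sub h2).tsum_eq_zero_add, ← h2.tsum_mul_left]
    simp only [eulerTerm, pow_zero, sub_self, zero_add]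
    refine tsum_congr fun k => ?_
    rw [recip_eq hq k, choose_two_succ]
    ring
  rw [h1.tsum_sub h2] at h3
  linear_combination h3

/-- Euler's expansion of `(-c;q)_∞`. -/
theorem qPochhammerInf_neg_eq_tsum {q : A} (hq : ‖q‖ < 1) {c : A} (hc : ‖c‖ < 1) :
    qPochhammerInf (-c) q = ∑' k, eulerTerm q c k := by
  have key (n : ℕ) : ∑' k, eulerTerm q c k =
      qPochhammer (-c) q n * ∑' k, eulerTerm q (c * q ^ n) k := by
    induction n with
    | zero => simp [qPochhammer_zero]
    | succ n ih =>
      rw [ih, tsum_eulerTerm_eq hq (norm_mul_lt_one hc (norm_pow_le_one hq n)), qPochhammer_succ]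
      ring_nf
  obtain ⟨C, hC0, hC⟩ := exists_norm_recip_le hq
  -- After `n` splittings the remaining series has argument `c qⁿ → 0`, and the series at `0`
  -- reduces to its term `k = 0`.
  have hlim : Tendsto (fun n => ∑' k, eulerTerm q (c * q ^ n) k) atTop
      (𝓝 (∑' k, eulerTerm q 0 k)) := by
    refine tendsto_tsum_of_dominated_convergence
      (bound := fun k => ‖c‖ ^ k * C)
      ((summable_geometric_of_lt_one (norm_nonneg c) hc).mul_right C) (fun k => ?_)
      (Eventually.of_forall fun n k => (norm_eulerTerm_le hq hC _ k).trans ?_)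
    · have : Tendsto (fun n => c * q ^ n) atTop (𝓝 0) := by
        simpa using (tendsto_pow_atTop_nhds_zero_of_norm_lt_one hq).const_mul c
      exact ((this.pow k).mul_const _).mul_const _
    · gcongr
      exact (norm_mul_le _ _).trans (mul_le_of_le_one_right (norm_nonneg c) (norm_pow_le_one hq n))
  have h0 : ∑' k, eulerTerm q (0 : A) k = 1 := by
    rw [tsum_eq_single 0 (fun k hk => by simp [eulerTerm, hk])]
    simp [eulerTerm, recip_zero]
  rw [h0] at hlim
  have := (tendsto_qPochhammer hq (-c)).mul hlim
  simp only [← key, mul_one] at this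
  exact (tendsto_nhds_unique this tendsto_const_nhds)

end Basic

/-! ### Cauchy's series and Jacobi's triple product -/

section Theta

variable {A : Type*} [NormedCommRing A] [NormOneClass A] [CompleteSpace A]

/-- The term of Cauchy's series `∑ q^{m² + mt} / ((q;q)_m (q;q)_{m+t})`. -/
noncomputable def cauchyTerm {A : Type*} [CommRing A] (q : A) (t m : ℕ) : A :=
  q ^ (m ^ 2 + m * t) * recip q m * recip q (m + t)

lemma norm_cauchyTerm_le {q : A} (hq : ‖q‖ < 1) {C : ℝ} (hC : ∀ n, ‖recip q n‖ ≤ C) (t m : ℕ) :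
    ‖cauchyTerm q t m‖ ≤ ‖q‖ ^ m * C * C := by
  have hC0 : 0 ≤ C := (norm_nonneg _).trans (hC 0)
  refine (norm_mul_le _ _).trans (mul_le_mul ?_ (hC _) (norm_nonneg _) (by positivity))
  refine (norm_mul_le _ _).trans (mul_le_mul ?_ (hC _) (norm_nonneg _) (by positivity))
  exact norm_pow_le_of_le hq (by nlinarith [Nat.le_self_pow two_ne_zero m])

lemma summable_cauchyTerm {q : A} (hq : ‖q‖ < 1) (t : ℕ) : Summable (cauchyTerm q t) := by
  obtain ⟨C, -, hC⟩ := exists_norm_recip_le hq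
  exact Summable.of_norm_bounded
    (((summable_geometric_of_lt_one (norm_nonneg q) hq).mul_right C).mul_right C)
    (norm_cauchyTerm_le hq hC t)

lemma tendsto_tsum_cauchyTerm {q : A} (hq : ‖q‖ < 1) :
    Tendsto (fun t => ∑' m, cauchyTerm q t m) atTop
      (𝓝 (Ring.inverse (qPochhammerInf q q))) := by
  obtain ⟨C, -, hC⟩ := exists_norm_recip_le hq
  have := tendsto_tsum_of_dominated_convergence (𝓕 := atTop)
    (f := fun t m => cauchyTerm q t m)
    -- The factor `q^{mt}` kills every term with `m ≠ 0` as `t → ∞`.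
    (g := fun m => if m = 0 then Ring.inverse (qPochhammerInf q q) else 0)
    (((summable_geometric_of_lt_one (norm_nonneg q) hq).mul_right C).mul_right C)
    (fun m => ?_) (Eventually.of_forall fun t m => norm_cauchyTerm_le hq hC t m)
  · simpa using this
  · have he : Tendsto (fun t => recip q (m + t)) atTop
        (𝓝 (Ring.inverse (qPochhammerInf q q))) := by
      simpa only [add_comm m] using (tendsto_add_atTop_iff_nat m).2 (tendsto_recip hq)
    rcases eq_or_ne m 0 with rfl | hm
    · simpa [cauchyTerm, recip_zero] using he
    · have := (((tendsto_pow_atTop_nhds_zero_of_norm_lt_one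
        (norm_pow_lt_one hq hm)).const_mul (q ^ m ^ 2)).mul_const (recip q m)).mul he
      simpa [cauchyTerm, hm, pow_add, pow_mul] using this

/-- Termwise with an index shift: `recip_eq` brings all terms over common denominators, the
numerators combine to `1 - q^{m+1}`, and this cancels the last factor of `(q;q)_{m+1}`. -/
lemma tsum_cauchyTerm_sub {q : A} (hq : ‖q‖ < 1) (t : ℕ) :
    ∑' m, cauchyTerm q t m - ∑' m, cauchyTerm q (t + 1) m =
      -q ^ (t + 1) * (∑' m, cauchyTerm q (t + 1) m - ∑' m, cauchyTerm q (t + 2) m) := by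
  have h0 := summable_cauchyTerm hq t
  have h1 := summable_cauchyTerm hq (t + 1)
  have h2 := summable_cauchyTerm hq (t + 2)
  have key : ∑' m, (cauchyTerm q t m - cauchyTerm q (t + 1) m +
      q ^ (t + 1) * cauchyTerm q (t + 1) m) = q ^ (t + 1) * ∑' m, cauchyTerm q (t + 2) m := by
    rw [((h0.sub h1).add (h1.mul_left _)).tsum_eq_zero_add, ← h2.tsum_mul_left]
    have hz : cauchyTerm q t 0 - cauchyTerm q (t + 1) 0 +
        q ^ (t + 1) * cauchyTerm q (t + 1) 0 = 0 := by
      simp only [cauchyTerm, zero_add, recip_eq hq t]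
      ring
    rw [hz, zero_add]
    refine tsum_congr fun m => ?_
    simp only [cauchyTerm]
    rw [show m + 1 + t = m + t + 1 by ring, show m + 1 + (t + 1) = m + t + 1 + 1 by ring,
      show m + (t + 2) = m + t + 1 + 1 by ring, recip_eq hq m, recip_eq hq (m + t + 1)]
    ring
  rw [(h0.sub h1).tsum_add (h1.mul_left _), h0.tsum_sub h1, h1.tsum_mul_left] at key
  linear_combination key

/-- Consecutive differences in `t` satisfy a contraction that pushes them to ever larger `t`, where
they tend to `0`. So the sum does not depend on `t`, and its value is the limit as `t → ∞`. -/
theorem tsum_cauchyTerm {q : A} (hq : ‖q‖ < 1) (t : ℕ) :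
    ∑' m, cauchyTerm q t m = Ring.inverse (qPochhammerInf q q) := by
  set D : ℕ → A := fun t => ∑' m, cauchyTerm q t m with hD
  have hlim : Tendsto D atTop _ := tendsto_tsum_cauchyTerm hq
  have hstep (t : ℕ) : ‖D t - D (t + 1)‖ ≤ ‖q‖ * ‖D (t + 1) - D (t + 2)‖ := by
    rw [hD, tsum_cauchyTerm_sub hq t]
    refine (norm_mul_le _ _).trans (mul_le_mul_of_nonneg_right ?_ (norm_nonneg _))
    rw [norm_neg]
    simpa using norm_pow_le_of_le hq (Nat.le_add_left 1 t)
  have hiter (n : ℕ) : ∀ t, ‖D t - D (t + 1)‖ ≤ ‖q‖ ^ n * ‖D (t + n) - D (t + n + 1)‖ := by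
    induction n with
    | zero => simp
    | succ n ih =>
      intro t
      refine (ih t).trans ?_
      rw [pow_succ, mul_assoc]
      exact mul_le_mul_of_nonneg_left (hstep (t + n)) (by positivity)
  have hconst (t : ℕ) : D (t + 1) = D t := by
    have h1 : Tendsto (fun n => ‖D (t + n) - D (t + n + 1)‖) atTop (𝓝 0) := by
      have e1 := (tendsto_add_atTop_iff_nat t).2 hlim
      have e2 := (tendsto_add_atTop_iff_nat (t + 1)).2 hlim
      have := (e1.sub e2).norm
      simp only [sub_self, norm_zero] at this
      refine this.congr fun n => ?_
      rw [show n + t = t + n by ring, show n + (t + 1) = t + n + 1 by ring]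
    have h2 := (tendsto_pow_atTop_nhds_zero_of_lt_one (norm_nonneg q) hq).mul h1
    rw [mul_zero] at h2
    have h3 : ‖D t - D (t + 1)‖ ≤ 0 := ge_of_tendsto' h2 fun n => hiter n t
    exact (sub_eq_zero.1 (norm_le_zero_iff.1 h3)).symm
  have hall (n : ℕ) : D (n + t) = D t := by
    induction n with
    | zero => simp
    | succ n ih => rw [show n + 1 + t = n + t + 1 by ring, hconst, ih]
  have := (tendsto_add_atTop_iff_nat t).2 hlim
  simp only [hall] at this
  exact tendsto_nhds_unique tendsto_const_nhds this

/-- The triangular number `n(n+1)/2` of an integer. -/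
def tri (n : ℤ) : ℕ := (n * (n + 1) / 2).toNat

lemma two_mul_tri (n : ℤ) : 2 * (tri n : ℤ) = n * (n + 1) := by
  have h0 : 0 ≤ n * (n + 1) := by
    rcases le_or_gt 0 n with h | h
    · positivity
    · exact mul_nonneg_of_nonpos_of_nonpos h.le (by omega)
  rw [tri, Int.toNat_of_nonneg (by omega)]
  exact Int.mul_ediv_cancel' (Int.even_mul_succ_self n).two_dvd

lemma tri_natCast (n : ℕ) : tri n = n + n.choose 2 := by
  have h1 := two_mul_tri n
  have h2 := sq_eq_two_mul_choose_two_add n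
  zify at h2 ⊢
  linarith

lemma tri_neg_natCast (n : ℕ) : tri (-n) = n.choose 2 := by
  have h1 := two_mul_tri (-n)
  have h2 := sq_eq_two_mul_choose_two_add n
  zify at h2 ⊢
  linarith

/-- The term `a^{n(n+1)/2} b^{n(n-1)/2}` of the theta series. -/
def thetaTerm {A : Type*} [CommRing A] (a b : A) (n : ℤ) : A := a ^ tri n * b ^ tri (-n)

/-- Pairs of natural numbers correspond to their difference together with their minimum. -/
def diffMinEquiv : ℕ × ℕ ≃ ℤ × ℕ where
  toFun p := ((p.1 : ℤ) - p.2, min p.1 p.2)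
  invFun p := (p.2 + p.1.toNat, p.2 + (-p.1).toNat)
  left_inv p := by
    ext
    · simp; omega
    · simp; omega
  right_inv p := by
    ext
    · simp
    · simp; omega

/-- With difference `n` and minimum `m` as coordinates, the exponents separate into a theta part in
`n` alone and a term of Cauchy's series. -/
lemma eulerTerm_mul_eulerTerm {A : Type*} [CommRing A] (a b : A) (m n : ℕ) :
    eulerTerm (a * b) a (m + n) * eulerTerm (a * b) b m =
      a ^ (n + n.choose 2) * b ^ n.choose 2 * cauchyTerm (a * b) n m := by
  have h : m + (m + n).choose 2 + m.choose 2 = n.choose 2 + (m ^ 2 + m * n) := by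
    have h1 := sq_eq_two_mul_choose_two_add m
    have h2 := sq_eq_two_mul_choose_two_add n
    have h3 := sq_eq_two_mul_choose_two_add (m + n)
    nlinarith
  have h' : a ^ n * (a * b) ^ (m + (m + n).choose 2 + m.choose 2) =
      a ^ n * (a * b) ^ (n.choose 2 + (m ^ 2 + m * n)) := by rw [h]
  simp only [eulerTerm, cauchyTerm]
  calc _ = a ^ n * (a * b) ^ (m + (m + n).choose 2 + m.choose 2) *
        (recip (a * b) m * recip (a * b) (m + n)) := by
        rw [pow_add (a * b), pow_add (a * b), mul_pow a b m]; ring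
    _ = _ := by rw [h', pow_add (a * b), mul_pow a b (n.choose 2)]; ring

lemma eulerTerm_diffMinEquiv_symm {A : Type*} [CommRing A] (a b : A) (p : ℤ × ℕ) :
    eulerTerm (a * b) a (diffMinEquiv.symm p).1 * eulerTerm (a * b) b (diffMinEquiv.symm p).2 =
      thetaTerm a b p.1 * cauchyTerm (a * b) p.1.natAbs p.2 := by
  obtain ⟨n, m⟩ := p
  obtain ⟨k, rfl | rfl⟩ := n.eq_nat_or_neg
  · simpa [diffMinEquiv, thetaTerm, tri_natCast, tri_neg_natCast] using
      eulerTerm_mul_eulerTerm a b m k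
  -- A negative difference is the positive case with `a` and `b` exchanged.
  · have := eulerTerm_mul_eulerTerm b a m k
    rw [mul_comm b a] at this
    simp only [diffMinEquiv, Equiv.coe_fn_symm_mk, thetaTerm, tri_natCast, tri_neg_natCast,
      neg_neg, Int.natAbs_neg, Int.natAbs_natCast, Int.toNat_natCast, Int.toNat_neg_natCast,
      add_zero]
    rw [mul_comm, this]
    ring

/-- Jacobi's triple product identity. -/
theorem hasSum_thetaTerm {a b : A} (ha : ‖a‖ < 1) (hb : ‖b‖ < 1) :
    HasSum (thetaTerm a b) (qPochhammerInf (-a) (a * b) * qPochhammerInf (-b) (a * b) *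
      qPochhammerInf (a * b) (a * b)) := by
  have hQ : ‖a * b‖ < 1 := norm_mul_lt_one ha hb.le
  have hu := isUnit_qPochhammerInf hQ hQ
  have h1 := summable_norm_eulerTerm hQ ha
  have h2 := summable_norm_eulerTerm hQ hb
  have h3 : HasSum (fun p : ℕ × ℕ => eulerTerm (a * b) a p.1 * eulerTerm (a * b) b p.2)
      (qPochhammerInf (-a) (a * b) * qPochhammerInf (-b) (a * b)) := by
    rw [qPochhammerInf_neg_eq_tsum hQ ha, qPochhammerInf_neg_eq_tsum hQ hb,
      tsum_mul_tsum_of_summable_norm h1 h2]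
    exact (summable_mul_of_summable_norm h1 h2).hasSum
  have h4 : HasSum (fun p : ℤ × ℕ => thetaTerm a b p.1 * cauchyTerm (a * b) p.1.natAbs p.2)
      (qPochhammerInf (-a) (a * b) * qPochhammerInf (-b) (a * b)) := by
    rw [← diffMinEquiv.symm.hasSum_iff] at h3
    exact h3.congr_fun fun p => (eulerTerm_diffMinEquiv_symm a b p).symm
  -- The fibre over `n` is Cauchy's series with `t = |n|`, whose value is the same for all `n`, so
  -- it factors out of the theta series.
  have h5 := h4.prod_fiberwise (g := fun n => thetaTerm a b n *
      Ring.inverse (qPochhammerInf (a * b) (a * b))) fun n => by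
    rw [← tsum_cauchyTerm hQ n.natAbs]
    exact (summable_cauchyTerm hQ _).hasSum.mul_left _
  have h6 := h5.mul_right (qPochhammerInf (a * b) (a * b))
  simpa [mul_assoc, Ring.inverse_mul_cancel _ hu] using h6

end Theta

/-! ### The Bailey pair -/

section Bailey

variable {A : Type*} [NormedCommRing A] [NormOneClass A] [CompleteSpace A]

/-- `1 / (q;q)_n`, extended by `0` to the negative integers. -/
noncomputable def recipInt {A : Type*} [CommRing A] (q : A) (n : ℤ) : A :=
  if n < 0 then 0 else recip q n.toNat

lemma recipInt_natCast {A : Type*} [CommRing A] (q : A) (n : ℕ) :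
    recipInt q n = recip q n := by
  simp [recipInt]

lemma recipInt_of_neg {A : Type*} [CommRing A] (q : A) {n : ℤ} (h : n < 0) :
    recipInt q n = 0 := by
  simp [recipInt, h]

/-- Valid for all integers: at `n = 0` the factor `1 - q^0` vanishes like the left side, and for `n
< 0` both sides are `0`, so the truncation in `toNat` is harmless. -/
lemma recipInt_sub_one {q : A} (hq : ‖q‖ < 1) (n : ℤ) :
    recipInt q (n - 1) = (1 - q ^ n.toNat) * recipInt q n := by
  rcases lt_trichotomy n 0 with h | rfl | h
  · rw [recipInt_of_neg q h, recipInt_of_neg q (by omega), mul_zero]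
  · simp [recipInt_of_neg]
  · obtain ⟨k, rfl⟩ : ∃ k : ℕ, n = (k + 1 : ℕ) := ⟨(n - 1).toNat, by omega⟩
    rw [show ((k + 1 : ℕ) : ℤ) - 1 = (k : ℕ) by push_cast; ring, recipInt_natCast,
      recipInt_natCast, recip_eq hq k, Int.toNat_natCast]

lemma norm_recipInt_le {q : A} {C : ℝ} (h0 : 0 ≤ C) (hC : ∀ n, ‖recip q n‖ ≤ C) (n : ℤ) :
    ‖recipInt q n‖ ≤ C := by
  rw [recipInt]
  split_ifs
  · simpa
  · exact hC _

/-- A product of two reciprocals in which only finitely many `j` contribute. -/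
noncomputable def recipPair {A : Type*} [CommRing A] (q : A) (m n j : ℤ) : A :=
  recipInt q (m - j) * recipInt q (n + j)

lemma summable_mul_recipPair (q : A) (f : ℤ → A) (m n : ℤ) :
    Summable fun j => f j * recipPair q m n j := by
  refine summable_of_ne_finset_zero (s := Finset.Icc (-n) m) fun j hj => ?_
  rw [Finset.mem_Icc, not_and_or, not_le, not_le] at hj
  rcases hj with h | h
  · simp [recipPair, recipInt_of_neg q (show n + j < 0 by omega)]
  · simp [recipPair, recipInt_of_neg q (show m - j < 0 by omega)]

/-- The weight `(-1)^j q^{(3j²+j)/2}`. -/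
noncomputable def weight {A : Type*} [CommRing A] (q : A) (j : ℤ) : A :=
  thetaTerm (-q ^ 2) (-q) j

lemma weight_eq {A : Type*} [CommRing A] (q : A) (j : ℤ) :
    weight q j = (-1) ^ (tri j + tri (-j)) * q ^ (2 * tri j + tri (-j)) := by
  rw [weight, thetaTerm, neg_pow, neg_pow q]
  ring

/-- The sum `∑_j (-1)^j q^{(3j²+j)/2} / ((q;q)_{n-j} (q;q)_{n+c+j})`. -/
noncomputable def baileySum (q : A) (c n : ℤ) : A :=
  ∑' j, weight q j * recipPair q n (n + c) j

/-- Writing `1/(q;q)_{n+j}` as `(1 - q^{n+1+j})/(q;q)_{n+1+j}` leaves the error sum with weights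
`(-1)^j q^{3j(j+1)/2}`. The reflection `j ↦ -1 - j` fixes the denominators and changes the sign of
the weight, so that sum is zero. -/
lemma baileySum_zero_eq_one {q : A} (hq : ‖q‖ < 1) (n : ℕ) :
    baileySum q 0 n = baileySum q 1 n := by
  set v : ℤ → A := fun j => (-1) ^ (tri j + tri (-j)) * q ^ (3 * tri j) with hv
  have hz : ∑' j, v j * recipPair q n (n + 1) j = 0 := by
    have hs := summable_mul_recipPair q v n (n + 1)
    have hneg (k : ℕ) : v (-(k + 1)) * recipPair q n (n + 1) (-(k + 1)) =
        -(v k * recipPair q n (n + 1) k) := by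
      have e1 : tri (-(k + 1)) = tri k := by
        have h1 := two_mul_tri (-(k + 1))
        have h2 := two_mul_tri k
        zify; nlinarith
      have e2 : tri (k + 1) = tri (-k) + 2 * k + 1 := by
        have h1 := two_mul_tri (k + 1)
        have h2 := two_mul_tri (-k)
        zify; nlinarith
      have e3 : recipPair q n (n + 1) (-(k + 1)) = recipPair q n (n + 1) k := by
        rw [recipPair, recipPair, mul_comm]
        congr 2 <;> ring
      rw [e3, hv]
      simp only [neg_neg, e1, e2]
      rw [show tri k + (tri (-k) + 2 * k + 1) = tri k + tri (-k) + (2 * k + 1) by ring,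
        pow_add (-1 : A) _ (2 * k + 1), pow_succ (-1 : A) (2 * k), pow_mul]
      simp
    have hn := hs.comp_injective (i := fun k : ℕ => (k : ℤ)) Nat.cast_injective
    rw [(hn.hasSum.of_nat_of_neg_add_one (f := fun j => v j * recipPair q n (n + 1) j)
      (by simp only [hneg]; exact hn.hasSum.neg)).tsum_eq, add_neg_cancel]
  have hterm (j : ℤ) : weight q j * recipPair q n (n + 0) j =
      weight q j * recipPair q n (n + 1) j - q ^ (n + 1) * (v j * recipPair q n (n + 1) j) := by
    have h := recipInt_sub_one hq (n + 1 + j)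
    rw [recipPair, recipPair, show (n : ℤ) + 0 + j = n + 1 + j - 1 by ring, h]
    rcases lt_or_ge ((n : ℤ) + 1 + j) 0 with hj | hj
    · simp [recipInt_of_neg q hj]
    · have he : (n + 1 + j : ℤ).toNat + (2 * tri j + tri (-j)) = n + 1 + 3 * tri j := by
        have h1 := two_mul_tri j
        have h2 := two_mul_tri (-j)
        zify
        rw [Int.toNat_of_nonneg hj]
        linarith
      have hp : q ^ (n + 1 + j : ℤ).toNat * q ^ (2 * tri j + tri (-j)) =
          q ^ (n + 1) * q ^ (3 * tri j) := by rw [← pow_add, he, pow_add]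
      rw [weight_eq]
      simp only [hv]
      linear_combination (-(-1) ^ (tri j + tri (-j)) * recipInt q (n - j) *
        recipInt q (n + 1 + j)) * hp
  rw [baileySum, tsum_congr hterm, (summable_mul_recipPair q _ _ _).tsum_sub
    ((summable_mul_recipPair q _ _ _).mul_left _),
    (summable_mul_recipPair q v _ _).tsum_mul_left, hz, mul_zero, sub_zero, baileySum]

/-- Here `1/(q;q)_{n-j} = (1 - q^{n+1-j})/(q;q)_{n+1-j}` is used. The factor `q^{-j}` turns the
weight at `j` into the weight at `-j`, and the denominators are now even in `j`, so the second sum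
is `q^{n+1}` times the first. -/
lemma baileySum_one_eq {q : A} (hq : ‖q‖ < 1) (n : ℕ) :
    baileySum q 1 n = (1 - q ^ (n + 1)) * baileySum q 0 (n + 1 : ℕ) := by
  have hterm (j : ℤ) : weight q j * recipPair q n (n + 1) j =
      weight q j * recipPair q (n + 1) (n + 1) j -
        q ^ (n + 1) * (weight q (-j) * recipPair q (n + 1) (n + 1) (-j)) := by
    have h := recipInt_sub_one hq (n + 1 - j)
    rw [recipPair, recipPair, recipPair, show (n : ℤ) - j = n + 1 - j - 1 by ring, h]
    rcases lt_or_ge ((n : ℤ) + 1 - j) 0 with hj | hj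
    · simp [recipInt_of_neg q hj, recipInt_of_neg q (show (n : ℤ) + 1 + -j < 0 by omega)]
    · have he : (n + 1 - j : ℤ).toNat + (2 * tri j + tri (-j)) =
          n + 1 + (2 * tri (-j) + tri j) := by
        have h1 := two_mul_tri j
        have h2 := two_mul_tri (-j)
        zify
        rw [Int.toNat_of_nonneg hj]
        linarith
      have hp : q ^ (n + 1 - j : ℤ).toNat * q ^ (2 * tri j + tri (-j)) =
          q ^ (n + 1) * q ^ (2 * tri (-j) + tri j) := by rw [← pow_add, he, pow_add]
      rw [weight_eq, weight_eq, neg_neg, sub_neg_eq_add, ← sub_eq_add_neg,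
        add_comm (tri (-j)) (tri j)]
      linear_combination (-(-1) ^ (tri j + tri (-j)) * recipInt q (n + 1 - j) *
        recipInt q (n + 1 + j)) * hp
  have hs := summable_mul_recipPair q (weight q) (n + 1) (n + 1)
  have hs' : Summable fun j => weight q (-j) * recipPair q (n + 1) (n + 1) (-j) :=
    hs.comp_injective neg_injective
  have ht : ∑' j, weight q (-j) * recipPair q (n + 1) (n + 1) (-j) =
      ∑' j, weight q j * recipPair q (n + 1) (n + 1) j :=
    tsum_comp_neg fun j => weight q j * recipPair q (n + 1) (n + 1) j
  have h0 : baileySum q 0 (n + 1 : ℕ) = ∑' j, weight q j * recipPair q (n + 1) (n + 1) j := by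
    rw [baileySum, add_zero, Nat.cast_succ]
  have h1 : baileySum q 1 n = ∑' j, weight q j * recipPair q n (n + 1) j := rfl
  rw [h0, h1, tsum_congr hterm, hs.tsum_sub (hs'.mul_left _), hs'.tsum_mul_left, ht,
    sub_mul, one_mul]

lemma baileySum_zero {q : A} (hq : ‖q‖ < 1) (n : ℕ) : baileySum q 0 n = recip q n := by
  induction n with
  | zero =>
    rw [baileySum, tsum_eq_single 0]
    · simp [recipPair, weight, thetaTerm, tri, recipInt, recip_zero]
    · intro j hj
      rcases lt_or_gt_of_ne hj with h | h
      · simp [recipPair, recipInt_of_neg q h]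
      · simp [recipPair, recipInt_of_neg q (show -j < 0 by omega)]
  | succ n ih =>
    rw [baileySum_zero_eq_one hq, baileySum_one_eq hq, recip_eq hq] at ih
    exact (isUnit_one_sub_of_norm_lt_one (norm_pow_lt_one hq n.succ_ne_zero)).mul_left_cancel ih

lemma baileySum_one {q : A} (hq : ‖q‖ < 1) (n : ℕ) : baileySum q 1 n = recip q n := by
  rw [← baileySum_zero_eq_one hq, baileySum_zero hq]

end Bailey

/-! ### The Rogers–Ramanujan identities -/

section Identities

variable {A : Type*} [NormedCommRing A] [NormOneClass A] [CompleteSpace A]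

/-- The terms with `n < j` vanish, and `n = m + j` turns the rest into Cauchy's series with `t = 2j
+ c`. -/
lemma hasSum_mul_recipPair_natCast {q : A} (hq : ‖q‖ < 1) (c j : ℕ) :
    HasSum (fun n : ℕ => q ^ (n ^ 2 + c * n) * recipPair q n (n + c) j)
      (q ^ (j ^ 2 + c * j) * Ring.inverse (qPochhammerInf q q)) := by
  have hinj : Function.Injective fun m : ℕ => m + j := add_left_injective j
  rw [← hinj.hasSum_iff]
  · rw [← tsum_cauchyTerm hq (2 * j + c)]
    refine ((summable_cauchyTerm hq (2 * j + c)).hasSum.mul_left (q ^ (j ^ 2 + c * j))).congr_fun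
      fun m => ?_
    have e1 : ((m + j : ℕ) : ℤ) - j = m := by push_cast; ring
    have e2 : ((m + j : ℕ) : ℤ) + c + j = (m + (2 * j + c) : ℕ) := by push_cast; ring
    simp only [Function.comp_apply, recipPair, cauchyTerm]
    rw [e1, e2, recipInt_natCast, recipInt_natCast]
    ring
  · intro n hn
    have : n < j := by
      by_contra h
      exact hn ⟨n - j, by simp; omega⟩
    simp [recipPair, recipInt_of_neg q (show (n : ℤ) - j < 0 by omega)]

lemma recipPair_symm (q : A) (n : ℤ) (c j : ℤ) :
    recipPair q n (n + c) (-c - j) = recipPair q n (n + c) j := by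
  rw [recipPair, recipPair, mul_comm]
  congr 2 <;> ring

lemma hasSum_mul_recipPair {q : A} (hq : ‖q‖ < 1) {c : ℕ} (hc : c ≤ 1) (j : ℤ) :
    HasSum (fun n : ℕ => q ^ (n ^ 2 + c * n) * recipPair q n (n + c) j)
      (q ^ (j * (j + c)).toNat * Ring.inverse (qPochhammerInf q q)) := by
  have key (i : ℕ) : ((i : ℤ) * (i + c)).toNat = i ^ 2 + c * i := by
    rw [show (i : ℤ) * (i + c) = (i ^ 2 + c * i : ℕ) by push_cast; ring, Int.toNat_natCast]
  rcases le_or_gt 0 j with h | h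
  · obtain ⟨i, rfl⟩ := Int.eq_ofNat_of_zero_le h
    rw [key]
    exact hasSum_mul_recipPair_natCast hq c i
  -- The symmetry `j ↦ -c - j` maps negative indices to nonnegative ones; this is where `c ≤ 1` is
  -- needed.
  · obtain ⟨i, hi⟩ := Int.eq_ofNat_of_zero_le (show 0 ≤ -c - j by omega)
    have h1 := hasSum_mul_recipPair_natCast hq c i
    rw [← key, ← hi, show (-c - j) * (-c - j + c) = j * (j + c) by ring] at h1
    simpa only [recipPair_symm] using h1

lemma summable_norm_weight {q : A} (hq : ‖q‖ < 1) : Summable fun j => ‖weight q j‖ := by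
  have h (j : ℤ) : ‖weight q j‖ ≤ ‖q‖ ^ j.natAbs := by
    rw [weight_eq]
    have h1 : ‖((-1) ^ (tri j + tri (-j)) : A)‖ ≤ 1 := by
      rcases neg_one_pow_eq_or A (tri j + tri (-j)) with h | h <;> simp [h]
    refine (norm_mul_le _ _).trans ((mul_le_of_le_one_left (norm_nonneg _) h1).trans ?_)
    refine norm_pow_le_of_le hq ?_
    have h1 := two_mul_tri j
    have h2 := two_mul_tri (-j)
    zify
    rcases abs_cases j with ⟨h, h'⟩ | ⟨h, h'⟩ <;> rw [h] <;> nlinarith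
  refine Summable.of_nonneg_of_le (fun _ => norm_nonneg _) h ?_
  have := summable_geometric_of_lt_one (norm_nonneg q) hq
  exact Summable.of_nat_of_neg (by simpa using this) (by simpa using this)

lemma summable_weight_mul {q : A} (hq : ‖q‖ < 1) (c : ℕ) :
    Summable fun p : ℕ × ℤ =>
      q ^ (p.1 ^ 2 + c * p.1) * (weight q p.2 * recipPair q p.1 (p.1 + c) p.2) := by
  obtain ⟨C, h0, hC⟩ := exists_norm_recip_le hq
  have h1 := Summable.mul_of_nonneg
    ((summable_geometric_of_lt_one (norm_nonneg q) hq).mul_right (C * C))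
    (summable_norm_weight hq) (fun _ => by positivity) (fun _ => norm_nonneg _)
  refine Summable.of_norm_bounded h1 fun p => ?_
  have e1 : ‖q ^ (p.1 ^ 2 + c * p.1)‖ ≤ ‖q‖ ^ p.1 :=
    norm_pow_le_of_le hq (by nlinarith [Nat.le_self_pow two_ne_zero p.1])
  have e2 : ‖recipPair q p.1 (p.1 + c) p.2‖ ≤ C * C :=
    (norm_mul_le _ _).trans (mul_le_mul (norm_recipInt_le h0 hC _) (norm_recipInt_le h0 hC _)
      (norm_nonneg _) h0)
  calc _ ≤ ‖q‖ ^ p.1 * (‖weight q p.2‖ * (C * C)) := by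
        refine (norm_mul_le _ _).trans (mul_le_mul e1 ?_ (norm_nonneg _) (by positivity))
        exact (norm_mul_le _ _).trans (mul_le_mul_of_nonneg_left e2 (norm_nonneg _))
    _ = _ := by ring

/-- The Bailey transform: expand `1/(q;q)_n` by the Bailey pair, exchange the absolutely convergent
sums, and evaluate the sum over `n`. -/
lemma tsum_mul_recip_eq {q : A} (hq : ‖q‖ < 1) {c : ℕ} (hc : c ≤ 1) :
    ∑' n : ℕ, q ^ (n ^ 2 + c * n) * recip q n =
      ∑' j : ℤ, weight q j * (q ^ (j * (j + c)).toNat * Ring.inverse (qPochhammerInf q q)) := by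
  have hb (n : ℕ) : recip q n = ∑' j, weight q j * recipPair q n (n + c) j := by
    interval_cases c
    · exact (baileySum_zero hq n).symm
    · exact (baileySum_one hq n).symm
  have hs : Summable (Function.uncurry fun (n : ℕ) (j : ℤ) =>
    q ^ (n ^ 2 + c * n) * (weight q j * recipPair q n (n + c) j)) := summable_weight_mul hq c
  have hswap := hs.tsum_comm
  calc _ = ∑' n : ℕ, ∑' j : ℤ,
        q ^ (n ^ 2 + c * n) * (weight q j * recipPair q n (n + c) j) := by
        refine tsum_congr fun n => ?_
        rw [(summable_mul_recipPair q _ _ _).tsum_mul_left, ← hb]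
    _ = ∑' j : ℤ, ∑' n : ℕ,
        q ^ (n ^ 2 + c * n) * (weight q j * recipPair q n (n + c) j) :=
        hswap.symm
    _ = _ := by
        refine tsum_congr fun j => ?_
        rw [← ((hasSum_mul_recipPair hq hc j).mul_left (weight q j)).tsum_eq]
        exact tsum_congr fun n => by ring

lemma qPochhammer_five_mul {R : Type*} [CommRing R] (q : R) (n : ℕ) :
    qPochhammer q q (5 * n) = qPochhammer q (q ^ 5) n * qPochhammer (q ^ 4) (q ^ 5) n *
      (qPochhammer (q ^ 2) (q ^ 5) n * qPochhammer (q ^ 3) (q ^ 5) n *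
        qPochhammer (q ^ 5) (q ^ 5) n) := by
  induction n with
  | zero => simp [qPochhammer_zero]
  | succ n ih =>
    rw [show 5 * (n + 1) = 5 * n + 1 + 1 + 1 + 1 + 1 by ring]
    simp only [qPochhammer_succ, ih]
    ring

lemma qPochhammerInf_eq_five {q : A} (hq : ‖q‖ < 1) :
    qPochhammerInf q q = qPochhammerInf q (q ^ 5) * qPochhammerInf (q ^ 4) (q ^ 5) *
      (qPochhammerInf (q ^ 2) (q ^ 5) * qPochhammerInf (q ^ 3) (q ^ 5) *
        qPochhammerInf (q ^ 5) (q ^ 5)) := by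
  have h5 : ‖q ^ 5‖ < 1 := norm_pow_lt_one hq (by norm_num)
  refine tendsto_nhds_unique ((tendsto_qPochhammer hq q).comp
    (tendsto_id.const_mul_atTop' (show 0 < 5 by norm_num))) ?_
  have := ((tendsto_qPochhammer h5 q).mul (tendsto_qPochhammer h5 (q ^ 4))).mul
    (((tendsto_qPochhammer h5 (q ^ 2)).mul (tendsto_qPochhammer h5 (q ^ 3))).mul
      (tendsto_qPochhammer h5 (q ^ 5)))
  exact this.congr fun n => (qPochhammer_five_mul q n).symm

/-- If `(q;q)_∞ S` is the theta function `(a;q⁵)_∞ (b;q⁵)_∞ (q⁵;q⁵)_∞`, then the theta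
function cancels. -/
lemma sum_eq_of_theta {q P T S : A} (hP : IsUnit P) (hT : IsUnit T)
    (hPT : qPochhammerInf q q = P * T) (h : S = T * Ring.inverse (qPochhammerInf q q)) :
    S = Ring.inverse P := by
  have h1 := Ring.mul_inverse_cancel _ hP
  have h2 := Ring.mul_inverse_cancel _ (hP.mul hT)
  rw [h, hPT]
  linear_combination Ring.inverse P * h2 - (T * Ring.inverse (P * T)) * h1

/-- The first Rogers–Ramanujan identity. -/
theorem sumG_eq {q : A} (hq : ‖q‖ < 1) :
    sumG q = Ring.inverse (qPochhammerInf q (q ^ 5) * qPochhammerInf (q ^ 4) (q ^ 5)) := by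
  have hn {k : ℕ} (hk : k ≠ 0) : ‖q ^ k‖ < 1 := norm_pow_lt_one hq hk
  have h5 := hn (k := 5) (by norm_num)
  refine sum_eq_of_theta ((isUnit_qPochhammerInf hq h5).mul
    (isUnit_qPochhammerInf (hn (by norm_num)) h5))
    (((isUnit_qPochhammerInf (hn (by norm_num)) h5).mul
    (isUnit_qPochhammerInf (hn (by norm_num)) h5)).mul (isUnit_qPochhammerInf h5 h5))
    (qPochhammerInf_eq_five hq) ?_
  -- The total exponent `(3j²+j)/2 + j²` is `3 j(j+1)/2 + 2 j(j-1)/2`, which dictates `a` and `b`.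
  have hJ := hasSum_thetaTerm (a := -q ^ 3) (b := -q ^ 2) (by simpa using hn (k := 3) (by norm_num))
    (by simpa using hn (k := 2) (by norm_num))
  rw [neg_neg, neg_neg, show -q ^ 3 * -q ^ 2 = q ^ 5 by ring] at hJ
  have h := tsum_mul_recip_eq hq (show 0 ≤ 1 by norm_num)
  have e : sumG q = ∑' n : ℕ, q ^ (n ^ 2 + 0 * n) * recip q n := by
    simp [sumG, sumTermG, recip]
  rw [e, h, mul_comm (qPochhammerInf (q ^ 2) _), ← (hJ.mul_right _).tsum_eq]
  refine tsum_congr fun j => ?_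
  have hj : (j * (j + (0 : ℕ))).toNat = tri j + tri (-j) := by
    have h1 := two_mul_tri j
    have h2 := two_mul_tri (-j)
    rw [show j * (j + (0 : ℕ)) = (tri j + tri (-j) : ℕ) by push_cast; linarith, Int.toNat_natCast]
  rw [hj, weight, thetaTerm, thetaTerm, neg_pow (q ^ 3), neg_pow (q ^ 2), neg_pow (q ^ 2), neg_pow q]
  ring

/-- The second Rogers–Ramanujan identity. -/
theorem sumH_eq {q : A} (hq : ‖q‖ < 1) :
    sumH q = Ring.inverse (qPochhammerInf (q ^ 2) (q ^ 5) * qPochhammerInf (q ^ 3) (q ^ 5)) := by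
  have hn {k : ℕ} (hk : k ≠ 0) : ‖q ^ k‖ < 1 := norm_pow_lt_one hq hk
  have h5 := hn (k := 5) (by norm_num)
  refine sum_eq_of_theta ((isUnit_qPochhammerInf (hn (by norm_num)) h5).mul
    (isUnit_qPochhammerInf (hn (by norm_num)) h5))
    (((isUnit_qPochhammerInf hq h5).mul
    (isUnit_qPochhammerInf (hn (k := 4) (by norm_num)) h5)).mul (isUnit_qPochhammerInf h5 h5))
    ((qPochhammerInf_eq_five hq).trans (by ring)) ?_
  -- Now the exponent is `(3j²+j)/2 + j² + j = 4 j(j+1)/2 + j(j-1)/2`.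
  have hJ := hasSum_thetaTerm (a := -q ^ 4) (b := -q) (by simpa using hn (k := 4) (by norm_num))
    (by simpa using hq)
  rw [neg_neg, neg_neg, show -q ^ 4 * -q = q ^ 5 by ring] at hJ
  have h := tsum_mul_recip_eq hq (show 1 ≤ 1 by norm_num)
  have e : sumH q = ∑' n : ℕ, q ^ (n ^ 2 + 1 * n) * recip q n := by
    refine tsum_congr fun n => ?_
    rw [sumTermH, recip]
    ring
  rw [e, h, mul_comm (qPochhammerInf q _), ← (hJ.mul_right _).tsum_eq]
  refine tsum_congr fun j => ?_
  have hj : (j * (j + (1 : ℕ))).toNat = 2 * tri j := by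
    have h1 := two_mul_tri j
    rw [show j * (j + (1 : ℕ)) = (2 * tri j : ℕ) by push_cast; linarith, Int.toNat_natCast]
  rw [hj, weight, thetaTerm, thetaTerm, neg_pow (q ^ 4), neg_pow (q ^ 2), neg_pow q]
  ring

end Identities

/-! ### Two finite `q`-binomial sums by generating functions -/

section QBinomial

variable {A : Type*} [NormedCommRing A] [NormOneClass A] [CompleteSpace A]

/-- The generating function `∑ z^n / (q;q)_n`. -/
noncomputable def recipSeries {A : Type*} [CommRing A] (q : A) : PowerSeries A :=
  PowerSeries.mk (recip q)

lemma rescale_recipSeries {q : A} (hq : ‖q‖ < 1) :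
    PowerSeries.rescale q (recipSeries q) = (1 - PowerSeries.X) * recipSeries q := by
  ext n
  rw [PowerSeries.coeff_rescale, sub_mul, one_mul, map_sub]
  cases n with
  | zero => simp [recipSeries]
  | succ n =>
    rw [PowerSeries.coeff_succ_X_mul]
    simp only [recipSeries, PowerSeries.coeff_mk]
    rw [recip_eq hq n]
    ring

/-- The coefficient recurrence of a power series `f` with `f(qz) = (1 - z) f(z)`. -/
lemma coeff_eq_recip {q : A} (hq : ‖q‖ < 1) {f : PowerSeries A}
    (hf : PowerSeries.rescale q f = (1 - PowerSeries.X) * f)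
    (h0 : PowerSeries.coeff 0 f = 1) (n : ℕ) : PowerSeries.coeff n f = recip q n := by
  induction n with
  | zero => rw [h0, recip_zero]
  | succ n ih =>
    have h := congrArg (PowerSeries.coeff (n + 1)) hf
    rw [PowerSeries.coeff_rescale, sub_mul, one_mul, map_sub, PowerSeries.coeff_succ_X_mul, ih,
      recip_eq hq n] at h
    refine (isUnit_one_sub_of_norm_lt_one (norm_pow_lt_one hq (Nat.add_one_ne_zero n))).mul_left_cancel ?_
    linear_combination -h

/-- With `E` the generating function for base `q²`, the product `E(z) E(qz)` satisfies the
first-order equation `f(qz) = (1 - z) f(z)` that characterizes the generating function for base `q`.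
-/
lemma sum_pow_mul_recip_sq {q : A} (hq : ‖q‖ < 1) (n : ℕ) :
    ∑ p ∈ Finset.HasAntidiagonal.antidiagonal n, q ^ p.2 * recip (q ^ 2) p.1 * recip (q ^ 2) p.2 =
      recip q n := by
  have h2 := norm_pow_lt_one hq two_ne_zero
  have hE := rescale_recipSeries h2
  rw [← coeff_eq_recip hq
    (f := recipSeries (q ^ 2) * PowerSeries.rescale q (recipSeries (q ^ 2))) ?_ ?_ n,
    PowerSeries.coeff_mul]
  · refine Finset.sum_congr rfl fun p _ => ?_
    simp only [PowerSeries.coeff_rescale, recipSeries, PowerSeries.coeff_mk]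
    ring
  · rw [map_mul, PowerSeries.rescale_rescale, ← sq, hE]
    ring
  · rw [PowerSeries.coeff_mul]
    simp [PowerSeries.coeff_rescale, recipSeries, recip_zero, -PowerSeries.coeff_zero_eq_constantCoeff]

/-- Gauss' sum. For the generating function `e` in base `q`, the product `f(z) = e(z) e(-z)`
satisfies `f(qz) = (1 - z²) f(z)`, a recurrence that links coefficients two apart; the one of index
1 is zero. -/
lemma sum_neg_one_pow_mul_recip {q : A} (hq : ‖q‖ < 1) (n : ℕ) :
    ∑ p ∈ Finset.HasAntidiagonal.antidiagonal n, (-1) ^ p.2 * recip q p.1 * recip q p.2 =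
      if Even n then recip (q ^ 2) (n / 2) else 0 := by
  have h2 := norm_pow_lt_one hq two_ne_zero
  have hE := rescale_recipSeries hq
  set f := recipSeries q * PowerSeries.rescale (-1) (recipSeries q) with hf
  have hc (n : ℕ) : PowerSeries.coeff n f =
      ∑ p ∈ Finset.HasAntidiagonal.antidiagonal n, (-1) ^ p.2 * recip q p.1 * recip q p.2 := by
    rw [hf, PowerSeries.coeff_mul]
    refine Finset.sum_congr rfl fun p _ => ?_
    simp only [PowerSeries.coeff_rescale, recipSeries, PowerSeries.coeff_mk]
    ring
  have hr : PowerSeries.rescale q f = f - PowerSeries.X * (PowerSeries.X * f) := by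
    have h3 : PowerSeries.rescale q (PowerSeries.rescale (-1) (recipSeries q)) =
        (1 + PowerSeries.X) * PowerSeries.rescale (-1) (recipSeries q) := by
      rw [PowerSeries.rescale_rescale, mul_comm, ← PowerSeries.rescale_rescale, hE, map_mul,
        map_sub, map_one, PowerSeries.rescale_X]
      simp
    rw [hf, map_mul, h3, hE]
    ring
  rw [← hc]
  induction n using Nat.twoStepInduction with
  | zero => simp [hc, recip_zero, -PowerSeries.coeff_zero_eq_constantCoeff]
  | one =>
    have h := recip_eq hq 0
    rw [hc, Finset.Nat.antidiagonal_succ]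
    simp [recip_zero]
  | more n ih _ =>
    have h := congrArg (PowerSeries.coeff (n + 1 + 1)) hr
    rw [PowerSeries.coeff_rescale, map_sub, PowerSeries.coeff_succ_X_mul,
      PowerSeries.coeff_succ_X_mul, ih] at h
    refine (isUnit_one_sub_of_norm_lt_one
      (norm_pow_lt_one hq (Nat.add_one_ne_zero (n + 1)))).mul_left_cancel ?_
    have h' : (1 - q ^ (n + 1 + 1)) * PowerSeries.coeff (n + 1 + 1) f =
        if Even n then recip (q ^ 2) (n / 2) else 0 := by linear_combination -h
    rw [h']
    by_cases he : Even n
    · obtain ⟨k, rfl⟩ := he.two_dvd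
      have e1 : (2 * k + 2) / 2 = k + 1 := by omega
      have e2 : Even (2 * k + 2) := by simp [Nat.even_add]
      rw [if_pos he, if_pos e2, e1, Nat.mul_div_cancel_left k two_pos, recip_eq h2 k]
      ring
    · have e2 : ¬ Even (n + 2) := by simpa [Nat.even_add] using he
      rw [if_neg he, if_neg e2, mul_zero]

end QBinomial

/-! ### Double sums along antidiagonals -/

section DoubleSum

variable {A : Type*} [NormedCommRing A] [NormOneClass A] [CompleteSpace A]

/-- Expanding `(-c pⁿ;p)_∞` by Euler's formula and collecting along antidiagonals. -/
lemma tsum_mul_qPochhammerInf {p c : A} (hp : ‖p‖ < 1) (hc : ‖c‖ < 1) {u : ℕ → A}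
    (hu : Summable fun n => ‖u n‖) :
    ∑' n, u n * recip p n * qPochhammerInf (-(c * p ^ n)) p =
      ∑' N, ∑ x ∈ Finset.HasAntidiagonal.antidiagonal N,
        u x.1 * c ^ x.2 * p ^ (x.1 * x.2 + x.2.choose 2) * recip p x.1 * recip p x.2 := by
  obtain ⟨C, h0, hC⟩ := exists_norm_recip_le hp
  have hcn (n : ℕ) : ‖c * p ^ n‖ < 1 := norm_mul_lt_one hc (norm_pow_le_one hp n)
  set g : ℕ × ℕ → A := fun x =>
    u x.1 * c ^ x.2 * p ^ (x.1 * x.2 + x.2.choose 2) * recip p x.1 * recip p x.2 with hg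
  have hsum : Summable g := by
    have h1 := Summable.mul_of_nonneg (hu.mul_right C)
      ((summable_geometric_of_lt_one (norm_nonneg c) hc).mul_right C)
      (fun _ => by positivity) (fun _ => by positivity)
    refine Summable.of_norm_bounded h1 fun x => ?_
    calc ‖g x‖ ≤ ‖u x.1‖ * ‖c‖ ^ x.2 * 1 * C * C := by
          refine (norm_mul_le _ _).trans (mul_le_mul ?_ (hC _) (norm_nonneg _) (by positivity))
          refine (norm_mul_le _ _).trans (mul_le_mul ?_ (hC _) (norm_nonneg _) (by positivity))
          refine (norm_mul_le _ _).trans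
            (mul_le_mul ?_ (norm_pow_le_one hp _) (norm_nonneg _) (by positivity))
          exact (norm_mul_le _ _).trans
            (mul_le_mul_of_nonneg_left (norm_pow_le c _) (norm_nonneg _))
      _ = _ := by ring
  have h1 : ∑' n, u n * recip p n * qPochhammerInf (-(c * p ^ n)) p = ∑' x, g x := by
    rw [hsum.tsum_prod]
    refine tsum_congr fun n => ?_
    rw [qPochhammerInf_neg_eq_tsum hp (hcn n),
      ← (summable_norm_eulerTerm hp (hcn n)).of_norm.tsum_mul_left]
    refine tsum_congr fun k => ?_
    simp only [eulerTerm, hg]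
    ring
  have h2 := (Finset.HasAntidiagonal.sigmaAntidiagonalEquivProd.hasSum_iff.2 hsum.hasSum).sigma
    (g := fun N => ∑ x ∈ Finset.HasAntidiagonal.antidiagonal N, g x)
    fun N => Finset.hasSum (Finset.HasAntidiagonal.antidiagonal N) g
  rw [h1, h2.tsum_eq]

end DoubleSum

/-! ### Series evaluations behind Rogers' equations -/

section Dissection

variable {A : Type*} [NormedCommRing A] [NormOneClass A] [CompleteSpace A]

lemma qPochhammer_sq_eq {R : Type*} [CommRing R] (p : R) (n : ℕ) :
    qPochhammer (p ^ 2) (p ^ 2) n = qPochhammer p p n * qPochhammer (-p) p n := by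
  induction n with
  | zero => simp [qPochhammer_zero]
  | succ n ih =>
    simp only [qPochhammer_succ, ih]
    ring

lemma qPochhammer_two_mul {R : Type*} [CommRing R] (q : R) (n : ℕ) :
    qPochhammer q q (2 * n) = qPochhammer q (q ^ 2) n * qPochhammer (q ^ 2) (q ^ 2) n := by
  induction n with
  | zero => simp [qPochhammer_zero]
  | succ n ih =>
    rw [show 2 * (n + 1) = 2 * n + 1 + 1 by ring]
    simp only [qPochhammer_succ, ih]
    ring

lemma qPochhammer_two_mul_add_one {R : Type*} [CommRing R] (q : R) (n : ℕ) :
    qPochhammer q q (2 * n + 1) =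
      qPochhammer q (q ^ 2) (n + 1) * qPochhammer (q ^ 2) (q ^ 2) n := by
  rw [qPochhammer_succ, qPochhammer_two_mul, qPochhammer_succ]
  ring

lemma qPochhammerInf_sq_eq {p : A} (hp : ‖p‖ < 1) :
    qPochhammerInf (p ^ 2) (p ^ 2) = qPochhammerInf p p * qPochhammerInf (-p) p := by
  have := (tendsto_qPochhammer hp p).mul (tendsto_qPochhammer hp (-p))
  simp only [← qPochhammer_sq_eq] at this
  exact tendsto_nhds_unique (tendsto_qPochhammer (norm_pow_lt_one hp two_ne_zero) _) this

lemma qPochhammerInf_eq_two {q : A} (hq : ‖q‖ < 1) :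
    qPochhammerInf q q = qPochhammerInf q (q ^ 2) * qPochhammerInf (q ^ 2) (q ^ 2) := by
  have h2 : ‖q ^ 2‖ < 1 := norm_pow_lt_one hq two_ne_zero
  have := (tendsto_qPochhammer h2 q).mul (tendsto_qPochhammer h2 (q ^ 2))
  simp only [← qPochhammer_two_mul] at this
  exact tendsto_nhds_unique ((tendsto_qPochhammer hq q).comp
    (tendsto_id.const_mul_atTop' (show 0 < 2 by norm_num))) this

/-- Bookkeeping for the next lemmas: an infinite product `T` absorbs the part `y` of the denominator
`x`, leaving the tail `S` over `(q;q)_n`. -/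
lemma recip_mul_eq {q x y S T : A} (hq : ‖q‖ < 1) {n : ℕ} {r : A} (hr : r * x = 1)
    (hx : x = qPochhammer q q n * y) (hT : T = y * S) :
    r * T = recip q n * S := by
  have h := qPochhammer_mul_recip hq n
  rw [hx] at hr
  rw [hT]
  linear_combination (-r * y * S) * h + recip q n * S * hr

lemma recip_sq_mul {p : A} (hp : ‖p‖ < 1) (n : ℕ) :
    recip (p ^ 2) n * qPochhammerInf (-p) p = recip p n * qPochhammerInf (-(p * p ^ n)) p := by
  have h := qPochhammer_mul_recip (norm_pow_lt_one hp two_ne_zero) n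
  refine recip_mul_eq hp ((mul_comm _ _).trans h) (qPochhammer_sq_eq p n) ?_
  rw [qPochhammerInf_eq_qPochhammer_mul hp (-p) n, neg_mul]

lemma recip_two_mul_mul {q : A} (hq : ‖q‖ < 1) (n : ℕ) :
    recip q (2 * n) * qPochhammerInf q (q ^ 2) =
      recip (q ^ 2) n * qPochhammerInf (-(-q * (q ^ 2) ^ n)) (q ^ 2) := by
  have h2 : ‖q ^ 2‖ < 1 := norm_pow_lt_one hq two_ne_zero
  have h := qPochhammer_mul_recip hq (2 * n)
  refine recip_mul_eq h2 ((mul_comm _ _).trans h)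
    ((qPochhammer_two_mul q n).trans (mul_comm _ _)) ?_
  rw [qPochhammerInf_eq_qPochhammer_mul h2 q n, neg_mul, neg_neg]

lemma recip_two_mul_add_one_mul {q : A} (hq : ‖q‖ < 1) (n : ℕ) :
    recip q (2 * n + 1) * qPochhammerInf q (q ^ 2) =
      recip (q ^ 2) n * qPochhammerInf (-(-q ^ 3 * (q ^ 2) ^ n)) (q ^ 2) := by
  have h2 : ‖q ^ 2‖ < 1 := norm_pow_lt_one hq two_ne_zero
  have h := qPochhammer_mul_recip hq (2 * n + 1)
  refine recip_mul_eq h2 ((mul_comm _ _).trans h)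
    ((qPochhammer_two_mul_add_one q n).trans (mul_comm _ _)) ?_
  rw [qPochhammerInf_eq_qPochhammer_mul h2 q (n + 1)]
  congr 2
  ring

lemma summable_norm_pow {q : A} (hq : ‖q‖ < 1) {f : ℕ → ℕ} (hf : ∀ n, n ≤ f n) :
    Summable fun n => ‖q ^ f n‖ :=
  (summable_geometric_of_lt_one (norm_nonneg q) hq).of_nonneg_of_le (fun _ => norm_nonneg _)
    fun n => norm_pow_le_of_le hq (hf n)

lemma le_sq_add (n k : ℕ) : n ≤ n ^ 2 + k :=
  (Nat.le_self_pow two_ne_zero n).trans (Nat.le_add_right _ _)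

lemma le_sq (n : ℕ) : n ≤ n ^ 2 := Nat.le_self_pow two_ne_zero n

/-- The exponent produced by collecting Euler's expansion along antidiagonals. -/
lemma sq_add_choose {x : ℕ × ℕ} {N : ℕ} (hx : x ∈ Finset.HasAntidiagonal.antidiagonal N) :
    x.1 ^ 2 + 2 * (x.1 * x.2 + x.2.choose 2) + x.2 = N ^ 2 := by
  rw [Finset.HasAntidiagonal.mem_antidiagonal] at hx
  have := sq_eq_two_mul_choose_two_add x.2
  subst hx
  nlinarith

/-- A double sum whose inner sums are the `q`-binomial sums with weight `qᵐ`. -/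
lemma tsum_mul_qPochhammerInf_neg_eq {q c : A} (hq : ‖q‖ < 1) (hc : ‖c‖ < 1) {r : A} (hr : ‖r‖ < 1)
    (hrq : r ^ 2 = q ^ 2) {f g : ℕ → ℕ} (hf : ∀ n, n ≤ f n)
    (h : ∀ N, ∀ x ∈ Finset.HasAntidiagonal.antidiagonal N,
      q ^ f x.1 * c ^ x.2 * (q ^ 2) ^ (x.1 * x.2 + x.2.choose 2) = r ^ g N * r ^ x.2) :
    ∑' n, q ^ f n * recip (q ^ 2) n * qPochhammerInf (-(c * (q ^ 2) ^ n)) (q ^ 2) =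
      ∑' N, r ^ g N * recip r N := by
  rw [tsum_mul_qPochhammerInf (norm_pow_lt_one hq two_ne_zero) hc (summable_norm_pow hq hf)]
  refine tsum_congr fun N => ?_
  rw [← sum_pow_mul_recip_sq hr, hrq, Finset.mul_sum]
  refine Finset.sum_congr rfl fun x hx => ?_
  rw [h N x hx]
  ring

/-- A double sum whose inner sums are the `q`-binomial sums with weight `qⁿ`. -/
lemma tsum_mul_qPochhammerInf_neg_eq' {q c : A} (hq : ‖q‖ < 1) (hc : ‖c‖ < 1) {r : A}
    (hr : ‖r‖ < 1) (hrq : r ^ 2 = q ^ 2) {f g : ℕ → ℕ} (hf : ∀ n, n ≤ f n)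
    (h : ∀ N, ∀ x ∈ Finset.HasAntidiagonal.antidiagonal N,
      q ^ f x.1 * c ^ x.2 * (q ^ 2) ^ (x.1 * x.2 + x.2.choose 2) = r ^ g N * r ^ x.1) :
    ∑' n, q ^ f n * recip (q ^ 2) n * qPochhammerInf (-(c * (q ^ 2) ^ n)) (q ^ 2) =
      ∑' N, r ^ g N * recip r N := by
  rw [tsum_mul_qPochhammerInf (norm_pow_lt_one hq two_ne_zero) hc (summable_norm_pow hq hf)]
  refine tsum_congr fun N => ?_
  -- Swapping the antidiagonal moves the weight to the other coordinate.
  rw [← sum_pow_mul_recip_sq hr, ← Finset.Nat.sum_antidiagonal_swap, hrq, Finset.mul_sum]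
  refine Finset.sum_congr rfl fun x hx => ?_
  have hx' : x.swap ∈ Finset.HasAntidiagonal.antidiagonal N := by
    rw [Finset.HasAntidiagonal.mem_antidiagonal] at hx ⊢
    simpa [add_comm] using hx
  rw [h N x.swap hx']
  simp only [Prod.fst_swap, Prod.snd_swap]
  ring

/-- A double sum whose inner sums are Gauss' alternating `q`-binomial sums. -/
lemma tsum_mul_qPochhammerInf_eq_even {q c : A} (hq : ‖q‖ < 1) (hc : ‖c‖ < 1) {f g : ℕ → ℕ}
    (hf : ∀ n, n ≤ f n)
    (h : ∀ N, ∀ x ∈ Finset.HasAntidiagonal.antidiagonal N,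
      q ^ f x.1 * c ^ x.2 * (q ^ 2) ^ (x.1 * x.2 + x.2.choose 2) = q ^ g N * (-1) ^ x.2) :
    ∑' n, q ^ f n * recip (q ^ 2) n * qPochhammerInf (-(c * (q ^ 2) ^ n)) (q ^ 2) =
      ∑' N, q ^ g (2 * N) * recip (q ^ 4) N := by
  have h2 : ‖q ^ 2‖ < 1 := norm_pow_lt_one hq two_ne_zero
  rw [tsum_mul_qPochhammerInf h2 hc (summable_norm_pow hq hf)]
  have key (N : ℕ) : ∑ x ∈ Finset.HasAntidiagonal.antidiagonal N,
      q ^ f x.1 * c ^ x.2 * (q ^ 2) ^ (x.1 * x.2 + x.2.choose 2) * recip (q ^ 2) x.1 *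
        recip (q ^ 2) x.2 = if Even N then q ^ g N * recip (q ^ 4) (N / 2) else 0 := by
    have h4 := sum_neg_one_pow_mul_recip h2 N
    rw [← pow_mul] at h4
    rw [← mul_ite_zero, ← h4, Finset.mul_sum]
    refine Finset.sum_congr rfl fun x hx => ?_
    rw [h N x hx]
    ring
  rw [tsum_congr key]
  have hinj : Function.Injective fun n : ℕ => 2 * n := mul_right_injective₀ two_ne_zero
  rw [← hinj.tsum_eq]
  · refine tsum_congr fun n => ?_
    simp
  · intro n hn
    by_contra hne
    refine hn (if_neg fun he => hne ?_)
    obtain ⟨k, rfl⟩ := he.two_dvd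
    exact ⟨k, rfl⟩

lemma sumG_eq_tsum (q : A) : sumG q = ∑' n, q ^ n ^ 2 * recip q n := rfl

lemma sumH_eq_tsum (q : A) : sumH q = ∑' n, q ^ (n * (n + 1)) * recip q n := rfl

lemma summable_pow_mul_recip_comp {q s : A} (hq : ‖q‖ < 1) (hs : ‖s‖ < 1) {f : ℕ → ℕ}
    (hf : ∀ n, n ≤ f n) (g : ℕ → ℕ) : Summable fun n => q ^ f n * recip s (g n) := by
  obtain ⟨C, h0, hC⟩ := exists_norm_recip_le hs
  refine Summable.of_norm_bounded ((summable_norm_pow hq hf).mul_right C) fun n => ?_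
  exact (norm_mul_le _ _).trans (mul_le_mul_of_nonneg_left (hC _) (norm_nonneg _))

/-- The product cancels against `(q⁴;q⁴)_n` to leave `(-q^{2n+2};q²)_∞/(q²;q²)_n`. Expanding this
tail and completing the square gives `q^{N²}` times a `q`-binomial sum of value `1/(q;q)_N`. -/
lemma tsum_sq_mul_recip {q : A} (hq : ‖q‖ < 1) :
    (∑' n, q ^ n ^ 2 * recip (q ^ 4) n) * qPochhammerInf (-q ^ 2) (q ^ 2) = sumG q := by
  have h2 : ‖q ^ 2‖ < 1 := norm_pow_lt_one hq two_ne_zero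
  rw [sumG_eq_tsum, ← tsum_mul_qPochhammerInf_neg_eq hq h2 hq rfl le_sq,
    ← Summable.tsum_mul_right _
      (summable_pow_mul_recip_comp hq (norm_pow_lt_one hq four_ne_zero) le_sq _)]
  · refine tsum_congr fun n => ?_
    rw [mul_assoc, mul_assoc, ← recip_sq_mul h2, ← pow_mul]
  · intro N x hx
    simp only [← pow_mul, ← pow_add]
    congr 1
    have := sq_add_choose hx
    omega

lemma tsum_sq_add_mul_recip {q : A} (hq : ‖q‖ < 1) :
    (∑' n, q ^ (n ^ 2 + 2 * n) * recip (q ^ 4) n) * qPochhammerInf (-q ^ 2) (q ^ 2) =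
      sumH q := by
  have h2 : ‖q ^ 2‖ < 1 := norm_pow_lt_one hq two_ne_zero
  have h4 : ‖q ^ 4‖ < 1 := norm_pow_lt_one hq four_ne_zero
  rw [sumH_eq_tsum, ← tsum_mul_qPochhammerInf_neg_eq' hq h2 hq rfl (fun n => le_sq_add n (2 * n)),
    ← Summable.tsum_mul_right _ (summable_pow_mul_recip_comp hq h4 (fun n => le_sq_add n (2 * n)) _)]
  · refine tsum_congr fun n => ?_
    rw [mul_assoc, mul_assoc, ← recip_sq_mul h2, ← pow_mul]
  · intro N x hx
    simp only [← pow_mul, ← pow_add]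
    congr 1
    have := sq_add_choose hx
    rw [Finset.HasAntidiagonal.mem_antidiagonal] at hx
    have hN : N * (N + 1) = N ^ 2 + N := by ring
    omega

/-- The tail now has argument `-q`, so the inner sums alternate: Gauss' sum removes odd `N`, and `N
= 2m` contributes `q^{4m²}/(q⁴;q⁴)_m`. -/
lemma tsum_sq_mul_recip_even {q : A} (hq : ‖q‖ < 1) :
    (∑' n, q ^ n ^ 2 * recip q (2 * n)) * qPochhammerInf q (q ^ 2) = sumG (q ^ 4) := by
  have e : sumG (q ^ 4) = ∑' N, q ^ (2 * N) ^ 2 * recip (q ^ 4) N :=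
    tsum_congr fun N => by rw [sumTermG, recip, ← pow_mul]; ring_nf
  rw [e, ← tsum_mul_qPochhammerInf_eq_even (g := fun N => N ^ 2) hq
    (show ‖-q‖ < 1 by rwa [norm_neg]) le_sq,
    ← Summable.tsum_mul_right _ (summable_pow_mul_recip_comp hq hq le_sq _)]
  · refine tsum_congr fun n => ?_
    rw [mul_assoc, mul_assoc, recip_two_mul_mul hq]
  · intro N x hx
    rw [neg_pow, ← sq_add_choose hx, pow_add, pow_add, pow_mul]
    ring

lemma tsum_sq_add_mul_recip_odd {q : A} (hq : ‖q‖ < 1) :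
    (∑' n, q ^ (n ^ 2 + 2 * n) * recip q (2 * n + 1)) * qPochhammerInf q (q ^ 2) =
      sumH (q ^ 4) := by
  have e : sumH (q ^ 4) = ∑' N, q ^ ((2 * N) ^ 2 + 2 * (2 * N)) * recip (q ^ 4) N :=
    tsum_congr fun N => by rw [sumTermH, recip, ← pow_mul]; ring_nf
  rw [e, ← tsum_mul_qPochhammerInf_eq_even (g := fun N => N ^ 2 + 2 * N) hq
    (show ‖-q ^ 3‖ < 1 by rw [norm_neg]; exact norm_pow_lt_one hq (by norm_num))
    (fun n => le_sq_add n (2 * n)),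
    ← Summable.tsum_mul_right _
      (summable_pow_mul_recip_comp hq hq (fun n => le_sq_add n (2 * n)) _)]
  · refine tsum_congr fun n => ?_
    rw [mul_assoc, mul_assoc, recip_two_mul_add_one_mul hq]
  · intro N x hx
    have h := sq_add_choose hx
    rw [Finset.HasAntidiagonal.mem_antidiagonal] at hx
    rw [← h, ← hx, neg_pow, pow_add, pow_add, pow_add, pow_mul]
    ring

lemma tsum_sq_add_self_mul_recip_even {q : A} (hq : ‖q‖ < 1) :
    (∑' n, q ^ (n ^ 2 + n) * recip q (2 * n)) * qPochhammerInf q (q ^ 2) = sumG (-q) := by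
  rw [sumG_eq_tsum, ← tsum_mul_qPochhammerInf_neg_eq' hq (show ‖-q‖ < 1 by rwa [norm_neg])
    (show ‖-q‖ < 1 by rwa [norm_neg]) (neg_sq q) (fun n => le_sq_add n n),
    ← Summable.tsum_mul_right _ (summable_pow_mul_recip_comp hq hq (fun n => le_sq_add n n) _)]
  · refine tsum_congr fun n => ?_
    rw [mul_assoc, mul_assoc, recip_two_mul_mul hq]
  · intro N x hx
    have h := sq_add_choose hx
    -- The alternating signs are those of powers of `-q`, because `N²` and `N = x.1 + x.2` have the
    -- same parity. So the sum collapses in base `r = -q`.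
    have hs : (-1 : A) ^ x.2 = (-1) ^ (N ^ 2 + x.1) := by
      rw [Finset.HasAntidiagonal.mem_antidiagonal] at hx
      refine neg_one_pow_congr ?_
      rw [← hx]
      simp [Nat.even_add, parity_simps]
      tauto
    rw [neg_pow, ← pow_add (-q), neg_pow q (N ^ 2 + x.1), ← hs, pow_add q (N ^ 2), ← h, pow_add,
      pow_add, pow_add, pow_mul]
    ring

lemma tsum_sq_add_self_mul_recip_odd {q : A} (hq : ‖q‖ < 1) :
    (∑' n, q ^ (n ^ 2 + n) * recip q (2 * n + 1)) * qPochhammerInf q (q ^ 2) = sumH (-q) := by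
  rw [sumH_eq_tsum, ← tsum_mul_qPochhammerInf_neg_eq hq
    (show ‖-q ^ 3‖ < 1 by rw [norm_neg]; exact norm_pow_lt_one hq (by norm_num))
    (show ‖-q‖ < 1 by rwa [norm_neg]) (neg_sq q) (fun n => le_sq_add n n),
    ← Summable.tsum_mul_right _ (summable_pow_mul_recip_comp hq hq (fun n => le_sq_add n n) _)]
  · refine tsum_congr fun n => ?_
    rw [mul_assoc, mul_assoc, recip_two_mul_add_one_mul hq]
  · intro N x hx
    have h := sq_add_choose hx
    have hs : (-1 : A) ^ x.2 = (-1) ^ (N * (N + 1) + x.2) := by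
      rw [pow_add, (Nat.even_mul_succ_self N).neg_one_pow, one_mul]
    have hN : N * (N + 1) = N ^ 2 + N := by ring
    rw [Finset.HasAntidiagonal.mem_antidiagonal] at hx
    rw [neg_pow, ← pow_add (-q), neg_pow q, ← hs, pow_add q (N * (N + 1)), hN, ← h, ← hx, pow_add,
      pow_add, pow_add, pow_add, pow_mul]
    ring

end Dissection

/-! ### Convergence and Rogers' equations in normed rings -/

section RogersEquations

variable {A : Type*} [NormedCommRing A] [NormOneClass A] [CompleteSpace A]

lemma tprod_inverse_one_sub {t : ℕ → A} (ht : Summable fun j => ‖t j‖)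
    (h1 : ∀ j, ‖t j‖ < 1) :
    ∏' j, Ring.inverse (1 - t j) = Ring.inverse (∏' j, (1 - t j)) := by
  have h := (multipliable_one_sub ht).hasProd.mul (multipliable_inverse_one_sub ht h1).hasProd
  simp only [fun j => Ring.mul_inverse_cancel _ (isUnit_one_sub_of_norm_lt_one (h1 j))] at h
  have h' := h.unique hasProd_one
  have hu := Ring.mul_inverse_cancel _ (isUnit_tprod_one_sub ht h1)
  linear_combination (Ring.inverse (∏' j, (1 - t j))) * h' -
    (∏' j, Ring.inverse (1 - t j)) * hu

lemma hasProd_inverse_qPochhammer {a q : A} (ha : ‖a‖ < 1) (hq : ‖q‖ < 1) :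
    HasProd (fun j : ℕ => Ring.inverse (1 - a * q ^ j)) (Ring.inverse (qPochhammerInf a q)) := by
  have h1 := summable_norm_mul_pow hq a
  have h2 (j : ℕ) : ‖a * q ^ j‖ < 1 := norm_mul_lt_one ha (norm_pow_le_one hq j)
  rw [qPochhammerInf, ← tprod_inverse_one_sub h1 h2]
  exact (multipliable_inverse_one_sub h1 h2).hasProd

lemma hasProd_inverse_mul {a b q : A} (ha : ‖a‖ < 1) (hb : ‖b‖ < 1) (hq : ‖q‖ < 1) :
    HasProd (fun j : ℕ => Ring.inverse ((1 - a * q ^ j) * (1 - b * q ^ j)))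
      (Ring.inverse (qPochhammerInf a q * qPochhammerInf b q)) := by
  rw [Ring.mul_inverse_rev, mul_comm]
  refine ((hasProd_inverse_qPochhammer ha hq).mul (hasProd_inverse_qPochhammer hb hq)).congr_fun
    fun j => ?_
  rw [Ring.mul_inverse_rev, mul_comm]

lemma hasProd_prodFactorG {q : A} (hq : ‖q‖ < 1) :
    HasProd (prodFactorG q)
      (Ring.inverse (qPochhammerInf q (q ^ 5) * qPochhammerInf (q ^ 4) (q ^ 5))) := by
  refine (hasProd_inverse_mul hq (norm_pow_lt_one hq (by norm_num))
    (norm_pow_lt_one hq (by norm_num))).congr_fun fun j => ?_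
  rw [prodFactorG]
  ring_nf

lemma hasProd_prodFactorH {q : A} (hq : ‖q‖ < 1) :
    HasProd (prodFactorH q)
      (Ring.inverse (qPochhammerInf (q ^ 2) (q ^ 5) * qPochhammerInf (q ^ 3) (q ^ 5))) := by
  refine (hasProd_inverse_mul (norm_pow_lt_one hq (by norm_num))
    (norm_pow_lt_one hq (by norm_num)) (norm_pow_lt_one hq (by norm_num))).congr_fun fun j => ?_
  rw [prodFactorH]
  ring_nf

lemma hasProd_factorF {q : A} (hq : ‖q‖ < 1) :
    HasProd (factorF q)
      (qPochhammerInf (q ^ 8) (q ^ 8) * Ring.inverse (qPochhammerInf (q ^ 2) (q ^ 2))) := by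
  have h2 : ‖q ^ 2‖ < 1 := norm_pow_lt_one hq (by norm_num)
  refine ((multipliable_qPochhammer (norm_pow_lt_one hq (by norm_num)) (q ^ 8)).hasProd.mul
    (hasProd_inverse_qPochhammer h2 h2)).congr_fun fun j => ?_
  rw [factorF]
  ring_nf

lemma prodG_eq {q : A} (hq : ‖q‖ < 1) :
    prodG q = Ring.inverse (qPochhammerInf q (q ^ 5) * qPochhammerInf (q ^ 4) (q ^ 5)) :=
  (hasProd_prodFactorG hq).tprod_eq

lemma prodH_eq {q : A} (hq : ‖q‖ < 1) :
    prodH q = Ring.inverse (qPochhammerInf (q ^ 2) (q ^ 5) * qPochhammerInf (q ^ 3) (q ^ 5)) :=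
  (hasProd_prodFactorH hq).tprod_eq

theorem sumG_eq_prodG {q : A} (hq : ‖q‖ < 1) : sumG q = prodG q := by
  rw [sumG_eq hq, prodG_eq hq]

theorem sumH_eq_prodH {q : A} (hq : ‖q‖ < 1) : sumH q = prodH q := by
  rw [sumH_eq hq, prodH_eq hq]

theorem converges {q : A} (hq : ‖q‖ < 1) : Converges q := by
  have h5 : ‖q ^ 5‖ < 1 := norm_pow_lt_one hq (by norm_num)
  refine ⟨fun n hn => isUnit_one_sub_of_norm_lt_one (norm_pow_lt_one hq hn.ne'),
    summable_pow_mul_recip_comp hq hq le_sq id,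
    summable_pow_mul_recip_comp hq hq (fun n => ?_) id,
    (hasProd_prodFactorG hq).multipliable, (hasProd_prodFactorH hq).multipliable,
    (hasProd_factorF hq).multipliable, fun n hn => ⟨multipliable_qPochhammer h5 _,
      isUnit_qPochhammerInf (norm_pow_lt_one hq hn.ne') h5⟩⟩
  nlinarith

/-- Two factorizations of `(q⁴;q⁴)_∞` are compared: `(q⁴;q⁸)_∞ (q⁸;q⁸)_∞` and `(q²;q²)_∞
(-q²;q²)_∞`. -/
lemma F_mul {q : A} (hq : ‖q‖ < 1) :
    F q * qPochhammerInf (q ^ 4) ((q ^ 4) ^ 2) = qPochhammerInf (-q ^ 2) (q ^ 2) := by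
  have h2 : ‖q ^ 2‖ < 1 := norm_pow_lt_one hq two_ne_zero
  have h4 : ‖q ^ 4‖ < 1 := norm_pow_lt_one hq four_ne_zero
  have e1 := qPochhammerInf_eq_two h4
  have e2 := qPochhammerInf_sq_eq h2
  rw [← pow_mul] at e1 e2 ⊢
  have e3 := Ring.mul_inverse_cancel _ (isUnit_qPochhammerInf h2 h2)
  rw [F, (hasProd_factorF hq).tprod_eq]
  linear_combination Ring.inverse (qPochhammerInf (q ^ 2) (q ^ 2)) * (e2 - e1) +
    qPochhammerInf (-q ^ 2) (q ^ 2) * e3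

/-- If `S P = X`, where `S` splits into an even part and an odd part, then `X` satisfies the
equation that results from multiplying the two parts by `T`. -/
lemma eq_of_dissection {q : A} (hq : ‖q‖ < 1) {f : ℕ → ℕ} (hf : ∀ n, n ≤ f n) {X Y Z : A}
    (hX : (∑' n, q ^ f n * recip (q ^ 4) n) * qPochhammerInf (-q ^ 2) (q ^ 2) = X)
    (hY : (∑' n, q ^ f (2 * n) * recip (q ^ 4) (2 * n)) *
      qPochhammerInf (q ^ 4) ((q ^ 4) ^ 2) = Y)
    (hZ : (∑' n, q ^ f (2 * n + 1) * recip (q ^ 4) (2 * n + 1)) *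
      qPochhammerInf (q ^ 4) ((q ^ 4) ^ 2) = Z) :
    X = F q * (Y + Z) := by
  have h4 : ‖q ^ 4‖ < 1 := norm_pow_lt_one hq four_ne_zero
  have hs := summable_pow_mul_recip_comp hq h4 hf id
  have he : Summable fun n => q ^ f (2 * n) * recip (q ^ 4) (2 * n) :=
    hs.comp_injective (mul_right_injective₀ two_ne_zero)
  have ho : Summable fun n => q ^ f (2 * n + 1) * recip (q ^ 4) (2 * n + 1) :=
    hs.comp_injective ((add_left_injective 1).comp (mul_right_injective₀ two_ne_zero))
  have hsplit := tsum_even_add_odd (f := fun n => q ^ f n * recip (q ^ 4) n) he ho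
  rw [← hX, ← hY, ← hZ, ← hsplit, ← F_mul hq]
  ring

/-- The squares are `(2m)² = 4m²` and `(2m+1)² = 4(m²+m) + 1`, so both halves are series in `q⁴`,
the odd one times `q`. -/
theorem sumG_rogers {q : A} (hq : ‖q‖ < 1) :
    sumG q = F q * (sumG (q ^ 16) + q * sumH (-q ^ 4)) := by
  have h4 : ‖q ^ 4‖ < 1 := norm_pow_lt_one hq four_ne_zero
  refine eq_of_dissection hq le_sq (tsum_sq_mul_recip hq) ?_ ?_
  · have h := tsum_sq_mul_recip_even h4
    rw [← pow_mul q 4 4] at h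
    rw [← h]
    congr 1
    exact tsum_congr fun n => by ring_nf
  · rw [← tsum_sq_add_self_mul_recip_odd h4, ← mul_assoc, ← Summable.tsum_mul_left _
      (summable_pow_mul_recip_comp h4 h4 (fun n => le_sq_add n n) _)]
    congr 1
    exact tsum_congr fun n => by ring_nf

/-- At `n = 2m` and `n = 2m+1` the exponent `n² + 2n` equals `4(m²+m)` and `4(m²+2m) + 3`; the
latter explains the factor `q³`. -/
theorem sumH_rogers {q : A} (hq : ‖q‖ < 1) :
    sumH q = F q * (sumG (-q ^ 4) + q ^ 3 * sumH (q ^ 16)) := by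
  have h4 : ‖q ^ 4‖ < 1 := norm_pow_lt_one hq four_ne_zero
  refine eq_of_dissection hq (fun n => le_sq_add n (2 * n)) (tsum_sq_add_mul_recip hq) ?_ ?_
  · rw [← tsum_sq_add_self_mul_recip_even h4]
    congr 1
    exact tsum_congr fun n => by ring_nf
  · have h := tsum_sq_add_mul_recip_odd h4
    rw [← pow_mul q 4 4] at h
    rw [← h, ← mul_assoc, ← Summable.tsum_mul_left _
      (summable_pow_mul_recip_comp h4 h4 (fun n => le_sq_add n (2 * n)) _)]
    congr 1
    exact tsum_congr fun n => by ring_nf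

end RogersEquations

/-! ### Transfer along continuous ring homomorphisms -/

section Transfer

variable {A : Type*} [NormedCommRing A] [NormOneClass A] [CompleteSpace A]
  {B : Type*} [CommRing B] [TopologicalSpace B] [T2Space B]

/-- The unit hypothesis matters: `Ring.inverse` is `0` at nonunits, which a homomorphism may send to
units. -/
lemma map_inverse {A B : Type*} [CommRing A] [CommRing B] (φ : A →+* B) {x : A} (hx : IsUnit x) :
    φ (Ring.inverse x) = Ring.inverse (φ x) := by
  have h1 : φ x * φ (Ring.inverse x) = 1 := by
    rw [← map_mul, Ring.mul_inverse_cancel _ hx, map_one]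
  have h2 := Ring.inverse_mul_cancel _ (hx.map φ)
  linear_combination Ring.inverse (φ x) * h1 - φ (Ring.inverse x) * h2

lemma map_qPochhammer {A B : Type*} [CommRing A] [CommRing B] (φ : A →+* B) (a q : A) (n : ℕ) :
    φ (qPochhammer a q n) = qPochhammer (φ a) (φ q) n := by
  simp [qPochhammer]

variable (φ : A →+* B) {q : A}

lemma sumTermG_map (hq : ‖q‖ < 1) : sumTermG (φ q) = φ ∘ sumTermG q := by
  ext n
  simp [sumTermG, map_inverse φ (isUnit_qPochhammer hq hq n), map_qPochhammer]

lemma sumTermH_map (hq : ‖q‖ < 1) : sumTermH (φ q) = φ ∘ sumTermH q := by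
  ext n
  simp [sumTermH, map_inverse φ (isUnit_qPochhammer hq hq n), map_qPochhammer]

lemma prodFactorG_map (hq : ‖q‖ < 1) : prodFactorG (φ q) = φ ∘ prodFactorG q := by
  ext n
  have hu (k : ℕ) (hk : k ≠ 0) := isUnit_one_sub_of_norm_lt_one (norm_pow_lt_one hq hk)
  simp [prodFactorG, map_inverse φ ((hu (5 * n + 1) (by omega)).mul (hu (5 * n + 4) (by omega)))]

lemma prodFactorH_map (hq : ‖q‖ < 1) : prodFactorH (φ q) = φ ∘ prodFactorH q := by
  ext n
  have hu (k : ℕ) (hk : k ≠ 0) := isUnit_one_sub_of_norm_lt_one (norm_pow_lt_one hq hk)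
  simp [prodFactorH, map_inverse φ ((hu (5 * n + 2) (by omega)).mul (hu (5 * n + 3) (by omega)))]

lemma factorF_map (hq : ‖q‖ < 1) : factorF (φ q) = φ ∘ factorF q := by
  ext n
  have hu := isUnit_one_sub_of_norm_lt_one (norm_pow_lt_one hq (show 2 * n + 2 ≠ 0 by omega))
  simp [factorF, map_inverse φ hu]

variable {φ}

lemma sumG_map (hφ : Continuous φ) (hq : ‖q‖ < 1) : sumG (φ q) = φ (sumG q) := by
  rw [sumG, sumTermG_map φ hq]
  exact ((converges hq).2.1.hasSum.map φ hφ).tsum_eq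

lemma sumH_map (hφ : Continuous φ) (hq : ‖q‖ < 1) : sumH (φ q) = φ (sumH q) := by
  rw [sumH, sumTermH_map φ hq]
  exact ((converges hq).2.2.1.hasSum.map φ hφ).tsum_eq

lemma prodG_map (hφ : Continuous φ) (hq : ‖q‖ < 1) : prodG (φ q) = φ (prodG q) := by
  rw [prodG, prodFactorG_map φ hq]
  exact ((converges hq).2.2.2.1.hasProd.map φ hφ).tprod_eq

lemma prodH_map (hφ : Continuous φ) (hq : ‖q‖ < 1) : prodH (φ q) = φ (prodH q) := by
  rw [prodH, prodFactorH_map φ hq]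
  exact ((converges hq).2.2.2.2.1.hasProd.map φ hφ).tprod_eq

lemma F_map (hφ : Continuous φ) (hq : ‖q‖ < 1) : F (φ q) = φ (F q) := by
  rw [F, factorF_map φ hq]
  exact ((converges hq).2.2.2.2.2.1.hasProd.map φ hφ).tprod_eq

lemma hasProd_qPochhammer_map (hφ : Continuous φ) (hq : ‖q‖ < 1) (a : A) :
    HasProd (fun j : ℕ => 1 - φ a * φ q ^ j) (φ (qPochhammerInf a q)) :=
  ((multipliable_qPochhammer hq a).hasProd.map φ hφ).congr_fun fun j => by simp

lemma qPochhammerInf_map (hφ : Continuous φ) (hq : ‖q‖ < 1) (a : A) :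
    qPochhammerInf (φ a) (φ q) = φ (qPochhammerInf a q) :=
  (hasProd_qPochhammer_map hφ hq a).tprod_eq

lemma converges_map (hφ : Continuous φ) (hq : ‖q‖ < 1) : Converges (φ q) := by
  obtain ⟨h1, h2, h3, h4, h5, h6, h7⟩ := converges hq
  have hq5 : ‖q ^ 5‖ < 1 := norm_pow_lt_one hq (by norm_num)
  refine ⟨fun n hn => ?_, ?_, ?_, ?_, ?_, ?_, fun n hn => ⟨?_, ?_⟩⟩
  · simpa using (h1 n hn).map φ
  · rw [sumTermG_map φ hq]; exact h2.map φ hφ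
  · rw [sumTermH_map φ hq]; exact h3.map φ hφ
  · rw [prodFactorG_map φ hq]; exact h4.map φ hφ
  · rw [prodFactorH_map φ hq]; exact h5.map φ hφ
  · rw [factorF_map φ hq]; exact h6.map φ hφ
  · simpa using (hasProd_qPochhammer_map hφ hq5 (q ^ n)).multipliable
  · rw [← map_pow, ← map_pow, qPochhammerInf_map hφ hq5]
    exact (h7 n hn).2.map φ

end Transfer

/-! ### Integral power series as a complete normed ring -/

/-- The ring of integral power series, with the norm `2^{-order}`. -/
def IntSeries : Type := PowerSeries ℤ

namespace IntSeries

noncomputable instance commRing : CommRing IntSeries := inferInstanceAs (CommRing (PowerSeries ℤ))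

/-- The identity map to the usual ring of power series. -/
noncomputable def equiv : IntSeries ≃+* PowerSeries ℤ := RingEquiv.refl (PowerSeries ℤ)

/-- The indeterminate. -/
noncomputable def X : IntSeries := equiv.symm PowerSeries.X

lemma equiv_X : equiv X = PowerSeries.X := equiv.apply_symm_apply _

lemma X_pow_dvd_iff' (f : IntSeries) (n : ℕ) : X ^ n ∣ f ↔ PowerSeries.X ^ n ∣ equiv f := by
  rw [← map_dvd_iff equiv, map_pow, equiv_X]

open Classical in
/-- The norm `2^{-order}`. -/
noncomputable def normFun (f : IntSeries) : ℝ :=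
  if f = 0 then 0 else (1 / 2) ^ (PowerSeries.order (equiv f)).toNat

lemma normFun_zero : normFun 0 = 0 := if_pos rfl

lemma normFun_nonneg (f : IntSeries) : 0 ≤ normFun f := by
  rw [normFun]; split_ifs <;> positivity

lemma eq_zero_or_normFun_eq (f : IntSeries) : f = 0 ∨ ∃ n : ℕ, normFun f = (1 / 2) ^ n := by
  by_cases h : f = 0
  · exact Or.inl h
  · exact Or.inr ⟨_, if_neg h⟩

/-- Turns norm estimates into divisibility by powers of `X`, from which the norm axioms follow. -/
lemma normFun_le_iff (f : IntSeries) (n : ℕ) : normFun f ≤ (1 / 2) ^ n ↔ X ^ n ∣ f := by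
  by_cases h : f = 0
  · subst h
    rw [normFun_zero]
    exact ⟨fun _ => dvd_zero _, fun _ => by positivity⟩
  · rw [normFun, if_neg h, pow_le_pow_iff_right_of_lt_one₀ (by norm_num) (by norm_num)]
    have h' : equiv f ≠ 0 := (map_ne_zero_iff equiv equiv.injective).2 h
    rw [X_pow_dvd_iff']
    refine ⟨fun hn => (pow_dvd_pow _ hn).trans PowerSeries.X_pow_order_dvd, fun hd => ?_⟩
    by_contra! hlt
    exact PowerSeries.coeff_order h' (PowerSeries.X_pow_dvd_iff.1 hd _ hlt)

/-- The norm `2^{-order}` as a norm of the additive group. -/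
noncomputable def addGroupNorm : AddGroupNorm IntSeries where
  toFun := normFun
  map_zero' := normFun_zero
  add_le' f g := by
    rcases eq_zero_or_normFun_eq f with rfl | ⟨a, ha⟩
    · simp [normFun_zero]
    rcases eq_zero_or_normFun_eq g with rfl | ⟨b, hb⟩
    · simp [normFun_zero]
    have h1 := normFun_nonneg f
    have h2 := normFun_nonneg g
    rcases le_total a b with h | h
    · have := (normFun_le_iff (f + g) a).2 (dvd_add ((normFun_le_iff f a).1 ha.le)
        ((pow_dvd_pow X h).trans ((normFun_le_iff g b).1 hb.le)))
      linarith
    · have := (normFun_le_iff (f + g) b).2 (dvd_add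
        ((pow_dvd_pow X h).trans ((normFun_le_iff f a).1 ha.le)) ((normFun_le_iff g b).1 hb.le))
      linarith
  neg' f := by
    rcases eq_zero_or_normFun_eq f with rfl | ⟨a, ha⟩
    · simp
    · rcases eq_zero_or_normFun_eq (-f) with h | ⟨b, hb⟩
      · rw [neg_eq_zero.1 h, neg_zero]
      · have h1 := (normFun_le_iff (-f) a).2 ((dvd_neg.2 ((normFun_le_iff f a).1 ha.le)))
        have h2 := (normFun_le_iff f b).2 (dvd_neg.1 ((normFun_le_iff (-f) b).1 hb.le))
        rw [← ha] at h1
        rw [← hb] at h2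
        exact le_antisymm h1 h2
  eq_zero_of_map_eq_zero' f h := by
    rcases eq_zero_or_normFun_eq f with h' | ⟨a, ha⟩
    · exact h'
    · rw [ha] at h
      exact absurd h (by positivity)

noncomputable instance : NormedCommRing IntSeries :=
  { addGroupNorm.toNormedAddCommGroup, commRing with
    norm_mul_le := fun f g => by
      change normFun (f * g) ≤ normFun f * normFun g
      rcases eq_zero_or_normFun_eq f with rfl | ⟨a, ha⟩
      · simp [normFun_zero]
      rcases eq_zero_or_normFun_eq g with rfl | ⟨b, hb⟩
      · simp [normFun_zero]
      rw [ha, hb, ← pow_add, normFun_le_iff, pow_add]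
      exact mul_dvd_mul ((normFun_le_iff f a).1 ha.le) ((normFun_le_iff g b).1 hb.le) }

lemma norm_le_iff (f : IntSeries) (n : ℕ) : ‖f‖ ≤ (1 / 2) ^ n ↔ X ^ n ∣ f :=
  normFun_le_iff f n

lemma eq_zero_or_norm_eq (f : IntSeries) : f = 0 ∨ ∃ n : ℕ, ‖f‖ = (1 / 2) ^ n :=
  eq_zero_or_normFun_eq f

lemma X_pow_dvd_iff (f : IntSeries) (n : ℕ) :
    X ^ n ∣ f ↔ ∀ m < n, PowerSeries.coeff m (equiv f) = 0 := by
  rw [X_pow_dvd_iff', PowerSeries.X_pow_dvd_iff]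

lemma coeff_eq_of_dist_le {f g : IntSeries} {n : ℕ} (h : dist f g ≤ (1 / 2) ^ (n + 1)) :
    PowerSeries.coeff n (equiv f) = PowerSeries.coeff n (equiv g) := by
  rw [dist_eq_norm_sub, norm_le_iff, X_pow_dvd_iff] at h
  have := h n n.lt_succ_self
  rwa [map_sub, map_sub, sub_eq_zero] at this

instance : NormOneClass IntSeries where
  norm_one := by
    have h : (1 : IntSeries) ≠ 0 := equiv.symm.injective.ne (one_ne_zero (α := PowerSeries ℤ))
    change normFun 1 = 1
    rw [normFun, if_neg h, map_one, PowerSeries.order_one]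
    simp

instance : CompleteSpace IntSeries := by
  refine Metric.complete_of_cauchySeq_tendsto fun u hu => ?_
  have hN (n : ℕ) : ∃ N, ∀ k ≥ N, ∀ l ≥ N,
      PowerSeries.coeff n (equiv (u k)) = PowerSeries.coeff n (equiv (u l)) := by
    obtain ⟨N, hN⟩ := Metric.cauchySeq_iff.1 hu ((1 / 2) ^ (n + 1)) (by positivity)
    exact ⟨N, fun k hk l hl => coeff_eq_of_dist_le (hN k hk l hl).le⟩
  choose N hN using hN
  -- Each coefficient of a Cauchy sequence is eventually constant; the limit collects these stable
  -- values.
  let f : IntSeries := equiv.symm (PowerSeries.mk fun n => PowerSeries.coeff n (equiv (u (N n))))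
  refine ⟨f, Metric.tendsto_atTop.2 fun ε hε => ?_⟩
  obtain ⟨n, hn⟩ := exists_pow_lt_of_lt_one hε (show (1 / 2 : ℝ) < 1 by norm_num)
  refine ⟨(Finset.range n).sup N, fun k hk => lt_of_le_of_lt ?_ hn⟩
  rw [dist_eq_norm_sub, norm_le_iff, X_pow_dvd_iff]
  intro m hm
  have h1 : N m ≤ k := (Finset.le_sup (Finset.mem_range.2 hm)).trans hk
  rw [map_sub, map_sub, equiv.apply_symm_apply, PowerSeries.coeff_mk, hN m k h1 (N m) le_rfl,
    sub_self]

lemma norm_X_lt_one : ‖X‖ < 1 :=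
  lt_of_le_of_lt ((norm_le_iff X 1).2 (by rw [pow_one])) (by norm_num)

/-- The ring homomorphism from integral power series to power series over `R`. -/
noncomputable def toSeries (R : Type*) [CommRing R] : IntSeries →+* PowerSeries R :=
  (PowerSeries.map (Int.castRingHom R)).comp equiv.toRingHom

lemma toSeries_apply (R : Type*) [CommRing R] (f : IntSeries) :
    toSeries R f = PowerSeries.map (Int.castRingHom R) (equiv f) := rfl

lemma toSeries_X (R : Type*) [CommRing R] : toSeries R X = PowerSeries.X := by
  rw [toSeries_apply, equiv_X, PowerSeries.map_X]

/-- Each coefficient is locally constant for the norm, so no property of the topology on `R` is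
needed. -/
lemma continuous_toSeries (R : Type*) [CommRing R] [TopologicalSpace R] :
    Continuous (toSeries R) := by
  refine continuous_iff_continuousAt.2 fun f => ?_
  refine (PowerSeries.WithPiTopology.tendsto_iff_coeff_tendsto R _ _ _).2 fun n => ?_
  refine tendsto_const_nhds.congr' ?_
  filter_upwards [Metric.closedBall_mem_nhds f (show (0 : ℝ) < (1 / 2) ^ (n + 1) by positivity)]
    with g hg
  rw [toSeries_apply, toSeries_apply, PowerSeries.coeff_map, PowerSeries.coeff_map,
    coeff_eq_of_dist_le (Metric.mem_closedBall.1 hg)]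

lemma hasSubst_of_X_dvd {a : IntSeries} (ha : X ∣ a) : PowerSeries.HasSubst (equiv a) := by
  refine PowerSeries.HasSubst.of_constantCoeff_zero' (PowerSeries.X_dvd_iff.1 ?_)
  rw [← equiv_X]
  exact map_dvd equiv ha

/-- Substitution of a series without constant term. -/
noncomputable def substHom {a : IntSeries} (ha : X ∣ a) : IntSeries →+* IntSeries :=
  (equiv.symm.toRingHom.comp (PowerSeries.substAlgHom (R := ℤ) (hasSubst_of_X_dvd ha)).toRingHom).comp
    equiv.toRingHom

lemma equiv_substHom {a : IntSeries} (ha : X ∣ a) (f : IntSeries) :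
    equiv (substHom ha f) = PowerSeries.subst (equiv a) (equiv f) :=
  congrFun (PowerSeries.coe_substAlgHom (hasSubst_of_X_dvd ha)) (equiv f)

lemma substHom_X {a : IntSeries} (ha : X ∣ a) : substHom ha X = a := by
  apply equiv.injective
  rw [equiv_substHom, equiv_X, PowerSeries.subst_X (hasSubst_of_X_dvd ha)]

/-- Since `X ∣ a`, substitution does not lower the order and hence does not increase the norm. -/
lemma continuous_substHom {a : IntSeries} (ha : X ∣ a) : Continuous (substHom ha) := by
  refine AddMonoidHomClass.continuous_of_bound (substHom ha) 1 fun f => ?_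
  rw [one_mul]
  rcases eq_zero_or_norm_eq f with rfl | ⟨n, hn⟩
  · simp
  · rw [hn, norm_le_iff]
    obtain ⟨g, rfl⟩ := (norm_le_iff f n).1 hn.le
    rw [map_mul, map_pow, substHom_X]
    exact (pow_dvd_pow_of_dvd ha n).mul_right _

/-- The constant coefficient. -/
noncomputable def constHom : IntSeries →+* ℤ :=
  (PowerSeries.constantCoeff (R := ℤ)).comp equiv.toRingHom

lemma constHom_apply (f : IntSeries) : constHom f = PowerSeries.constantCoeff (equiv f) := rfl

lemma constHom_X : constHom X = 0 := by
  rw [constHom_apply, equiv_X, PowerSeries.constantCoeff_X]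

lemma continuous_constHom : Continuous constHom := by
  refine continuous_iff_continuousAt.2 fun f => tendsto_const_nhds.congr' ?_
  filter_upwards [Metric.closedBall_mem_nhds f (show (0 : ℝ) < (1 / 2) ^ (0 + 1) by positivity)]
    with g hg
  have := coeff_eq_of_dist_le (Metric.mem_closedBall.1 hg)
  rw [PowerSeries.coeff_zero_eq_constantCoeff] at this
  exact this.symm

lemma constantCoeff_toSeries (R : Type*) [CommRing R] (f : IntSeries) :
    PowerSeries.constantCoeff (toSeries R f) = ((constHom f : ℤ) : R) := by
  rw [toSeries_apply, ← PowerSeries.coeff_zero_eq_constantCoeff_apply, PowerSeries.coeff_map,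
    PowerSeries.coeff_zero_eq_constantCoeff_apply, constHom_apply, eq_intCast]

lemma toSeries_substHom (R : Type*) [CommRing R] {a : IntSeries} (ha : X ∣ a) (f : IntSeries) :
    toSeries R (substHom ha f) = PowerSeries.subst (toSeries R a) (toSeries R f) := by
  rw [toSeries_apply, equiv_substHom]
  exact PowerSeries.map_subst (hasSubst_of_X_dvd ha) (equiv f)

end IntSeries

section ZeroValues

variable {A : Type*} [CommRing A] [TopologicalSpace A]

lemma sumG_zero : sumG (0 : A) = 1 := by
  rw [sumG, tsum_eq_single 0 fun k hk => by simp [sumTermG, hk]]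
  simp [sumTermG, qPochhammer_zero]

lemma sumH_zero : sumH (0 : A) = 1 := by
  rw [sumH, tsum_eq_single 0 fun k hk => by simp [sumTermH, hk]]
  simp [sumTermH, qPochhammer_zero]

end ZeroValues

/-! ### Uniqueness of the solution of Rogers' equations -/

section Uniqueness

variable {R : Type*} [CommRing R]

lemma hasSubst_of_X_pow_dvd {a : PowerSeries R} {k : ℕ} (hk : k ≠ 0) (ha : PowerSeries.X ^ k ∣ a) :
    PowerSeries.HasSubst a :=
  PowerSeries.HasSubst.of_constantCoeff_zero' (PowerSeries.X_dvd_iff.1 ((dvd_pow_self _ hk).trans ha))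

/-- Substitution multiplies the order by at least 4, and `4(n+1) ≥ n+2`: the gain that drives the
induction for uniqueness. -/
lemma X_pow_dvd_subst {a f : PowerSeries R} (ha : PowerSeries.X ^ 4 ∣ a) {n : ℕ}
    (hf : PowerSeries.X ^ (n + 1) ∣ f) :
    (PowerSeries.X : PowerSeries R) ^ (n + 2) ∣ PowerSeries.subst a f := by
  have hs := hasSubst_of_X_pow_dvd four_ne_zero ha
  obtain ⟨g, rfl⟩ := hf
  rw [PowerSeries.subst_mul hs, PowerSeries.subst_pow hs, PowerSeries.subst_X hs]
  refine Dvd.dvd.mul_right ?_ _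
  refine (pow_dvd_pow _ (show n + 2 ≤ 4 * (n + 1) by omega)).trans ?_
  rw [pow_mul]
  exact pow_dvd_pow_of_dvd ha (n + 1)

/-- Rogers' equations and the constant terms determine a pair of power series. -/
theorem RogersEquations.unique [TopologicalSpace R] {G H G' H' : PowerSeries R}
    (h : RogersEquations G H) (h' : RogersEquations G' H')
    (hG : PowerSeries.constantCoeff G = PowerSeries.constantCoeff G')
    (hH : PowerSeries.constantCoeff H = PowerSeries.constantCoeff H') : G = G' ∧ H = H' := by
  have d16 : (PowerSeries.X : PowerSeries R) ^ 4 ∣ PowerSeries.X ^ 16 :=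
    pow_dvd_pow _ (by norm_num)
  have d4 : (PowerSeries.X : PowerSeries R) ^ 4 ∣ -PowerSeries.X ^ 4 := (dvd_refl _).neg_right
  have s16 := hasSubst_of_X_pow_dvd four_ne_zero d16
  have s4 := hasSubst_of_X_pow_dvd four_ne_zero d4
  -- The equations are linear, so the differences satisfy them too.
  have eG : G - G' = F PowerSeries.X * (PowerSeries.subst (PowerSeries.X ^ 16) (G - G') +
      PowerSeries.X * PowerSeries.subst (-PowerSeries.X ^ 4) (H - H')) := by
    rw [PowerSeries.subst_sub s16, PowerSeries.subst_sub s4]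
    linear_combination h.1 - h'.1
  have eH : H - H' = F PowerSeries.X * (PowerSeries.subst (-PowerSeries.X ^ 4) (G - G') +
      PowerSeries.X ^ 3 * PowerSeries.subst (PowerSeries.X ^ 16) (H - H')) := by
    rw [PowerSeries.subst_sub s16, PowerSeries.subst_sub s4]
    linear_combination h.2 - h'.2
  have key (n : ℕ) : PowerSeries.X ^ (n + 1) ∣ G - G' ∧ PowerSeries.X ^ (n + 1) ∣ H - H' := by
    induction n with
    | zero =>
      rw [zero_add, pow_one, PowerSeries.X_dvd_iff, PowerSeries.X_dvd_iff, map_sub, map_sub, hG,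
        hH, sub_self, sub_self]
      exact ⟨rfl, rfl⟩
    | succ n ih =>
      obtain ⟨ihG, ihH⟩ := ih
      constructor
      · rw [eG]
        exact (dvd_add (X_pow_dvd_subst d16 ihG) ((X_pow_dvd_subst d4 ihH).mul_left _)).mul_left _
      · rw [eH]
        exact (dvd_add (X_pow_dvd_subst d4 ihG) ((X_pow_dvd_subst d16 ihH).mul_left _)).mul_left _
  have hz {D : PowerSeries R} (hD : ∀ n, PowerSeries.X ^ (n + 1) ∣ D) : D = 0 :=
    PowerSeries.ext fun n => PowerSeries.X_pow_dvd_iff.1 (hD n) n n.lt_succ_self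
  exact ⟨sub_eq_zero.1 (hz fun n => (key n).1), sub_eq_zero.1 (hz fun n => (key n).2)⟩

end Uniqueness

/-! ### Formal power series over `R` -/

section Formal

open IntSeries

variable (R : Type*) [CommRing R] [TopologicalSpace R] [T2Space R]

lemma sumG_X : sumG (PowerSeries.X : PowerSeries R) = toSeries R (sumG IntSeries.X) := by
  rw [← toSeries_X, sumG_map (continuous_toSeries R) norm_X_lt_one]

lemma sumH_X : sumH (PowerSeries.X : PowerSeries R) = toSeries R (sumH IntSeries.X) := by
  rw [← toSeries_X, sumH_map (continuous_toSeries R) norm_X_lt_one]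

lemma sumG_X_eq_prodG : sumG (PowerSeries.X : PowerSeries R) = prodG PowerSeries.X := by
  rw [← toSeries_X, sumG_map (continuous_toSeries R) norm_X_lt_one,
    prodG_map (continuous_toSeries R) norm_X_lt_one, sumG_eq_prodG norm_X_lt_one]

lemma sumH_X_eq_prodH : sumH (PowerSeries.X : PowerSeries R) = prodH PowerSeries.X := by
  rw [← toSeries_X, sumH_map (continuous_toSeries R) norm_X_lt_one,
    prodH_map (continuous_toSeries R) norm_X_lt_one, sumH_eq_prodH norm_X_lt_one]

/-- The constant coefficient is a continuous homomorphism with `X ↦ 0`, so it evaluates the sum at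
`q = 0`. -/
lemma constantCoeff_sumG_X : PowerSeries.constantCoeff (sumG (PowerSeries.X : PowerSeries R)) = 1 := by
  rw [sumG_X, constantCoeff_toSeries, ← sumG_map continuous_constHom norm_X_lt_one, constHom_X,
    sumG_zero, Int.cast_one]

lemma constantCoeff_sumH_X : PowerSeries.constantCoeff (sumH (PowerSeries.X : PowerSeries R)) = 1 := by
  rw [sumH_X, constantCoeff_toSeries, ← sumH_map continuous_constHom norm_X_lt_one, constHom_X,
    sumH_zero, Int.cast_one]

lemma toSeries_qPochhammerInf (i : ℕ) :
    toSeries R (qPochhammerInf (IntSeries.X ^ i) (IntSeries.X ^ 5)) =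
      qPochhammerInf (PowerSeries.X ^ i) (PowerSeries.X ^ 5) := by
  rw [← qPochhammerInf_map (continuous_toSeries R) (norm_pow_lt_one norm_X_lt_one (by norm_num)),
    map_pow, map_pow, toSeries_X]

lemma toSeries_inverse_mul {i j : ℕ} (hi : i ≠ 0) (hj : j ≠ 0) :
    toSeries R (Ring.inverse (qPochhammerInf (IntSeries.X ^ i) (IntSeries.X ^ 5) *
      qPochhammerInf (IntSeries.X ^ j) (IntSeries.X ^ 5))) =
      Ring.inverse (qPochhammerInf (PowerSeries.X ^ i) (PowerSeries.X ^ 5) *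
        qPochhammerInf (PowerSeries.X ^ j) (PowerSeries.X ^ 5)) := by
  have hn {k : ℕ} (hk : k ≠ 0) := norm_pow_lt_one norm_X_lt_one hk
  have h5 := hn (show 5 ≠ 0 by norm_num)
  rw [map_inverse _ ((isUnit_qPochhammerInf (hn hi) h5).mul (isUnit_qPochhammerInf (hn hj) h5)),
    map_mul, toSeries_qPochhammerInf, toSeries_qPochhammerInf]

theorem rogersEquations_sum :
    RogersEquations (sumG (PowerSeries.X : PowerSeries R)) (sumH PowerSeries.X) := by
  have d16 : IntSeries.X ∣ IntSeries.X ^ 16 := dvd_pow_self _ (by norm_num)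
  have d4 : IntSeries.X ∣ -IntSeries.X ^ 4 := (dvd_pow_self _ (by norm_num)).neg_right
  have hX := norm_X_lt_one
  have hF : toSeries R (F IntSeries.X) = F PowerSeries.X := by
    rw [← F_map (continuous_toSeries R) hX, toSeries_X]
  have e16 : toSeries R (IntSeries.X ^ 16) = PowerSeries.X ^ 16 := by rw [map_pow, toSeries_X]
  have e4 : toSeries R (-IntSeries.X ^ 4) = -PowerSeries.X ^ 4 := by
    rw [map_neg, map_pow, toSeries_X]
  -- Evaluating the sums at `X ^ 16` and `-X ^ 4` is the same as substituting into their values at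
  -- `X`, which converts the normed-ring equations into the formal ones.
  have g16 := sumG_map (continuous_substHom d16) hX
  have g4 := sumG_map (continuous_substHom d4) hX
  have h16 := sumH_map (continuous_substHom d16) hX
  have h4 := sumH_map (continuous_substHom d4) hX
  rw [substHom_X] at g16 g4 h16 h4
  constructor
  · have h := congrArg (toSeries R) (sumG_rogers hX)
    rwa [map_mul, map_add, map_mul, g16, h4, toSeries_substHom, toSeries_substHom, hF, e16, e4,
      toSeries_X, ← sumG_X, ← sumH_X] at h
  · have h := congrArg (toSeries R) (sumH_rogers hX)
    rwa [map_mul, map_add, map_mul, h16, g4, toSeries_substHom, toSeries_substHom, hF, e16, e4,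
      map_pow, toSeries_X, ← sumG_X, ← sumH_X] at h

end Formal

theorem rogersEquationsAt_sum {q : ℂ} (hq : ‖q‖ < 1) : RogersEquationsAt sumG sumH q :=
  ⟨sumG_rogers hq, sumH_rogers hq⟩

theorem rogersEquationsAt_prod {q : ℂ} (hq : ‖q‖ < 1) : RogersEquationsAt prodG prodH q := by
  have h16 : ‖q ^ 16‖ < 1 := norm_pow_lt_one hq (by norm_num)
  have h4 : ‖-q ^ 4‖ < 1 := by rw [norm_neg]; exact norm_pow_lt_one hq (by norm_num)
  have h := rogersEquationsAt_sum hq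
  rw [RogersEquationsAt, sumG_eq_prodG hq, sumH_eq_prodH hq, sumG_eq_prodG h16,
    sumH_eq_prodH h16, sumG_eq_prodG h4, sumH_eq_prodH h4] at h
  exact h

end RogersRamanujan

open RogersRamanujan in
theorem mainTheorem1 :
    -- the analytic identities
    (∀ q : ℂ, ‖q‖ < 1 →
      Converges q ∧
      sumG q = prodG q ∧
      sumH q = prodH q ∧
      sumG q = (qPochhammerInf q (q ^ 5) * qPochhammerInf (q ^ 4) (q ^ 5))⁻¹ ∧
      sumH q = (qPochhammerInf (q ^ 2) (q ^ 5) * qPochhammerInf (q ^ 3) (q ^ 5))⁻¹ ∧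
      RogersEquationsAt sumG sumH q ∧
      RogersEquationsAt prodG prodH q) ∧
    (sumG (0 : ℂ) = 1 ∧ sumH (0 : ℂ) = 1 ∧ prodG (0 : ℂ) = 1 ∧ prodH (0 : ℂ) = 1) ∧
    -- the identities of formal power series
    (∀ (R : Type*) [CommRing R] [TopologicalSpace R] [T2Space R],
      Converges (PowerSeries.X : PowerSeries R) ∧
      sumG (PowerSeries.X : PowerSeries R) = prodG PowerSeries.X ∧
      sumH (PowerSeries.X : PowerSeries R) = prodH PowerSeries.X ∧
      sumG (PowerSeries.X : PowerSeries R) =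
        Ring.inverse (qPochhammerInf PowerSeries.X (PowerSeries.X ^ 5) *
          qPochhammerInf (PowerSeries.X ^ 4) (PowerSeries.X ^ 5)) ∧
      sumH (PowerSeries.X : PowerSeries R) =
        Ring.inverse (qPochhammerInf (PowerSeries.X ^ 2) (PowerSeries.X ^ 5) *
          qPochhammerInf (PowerSeries.X ^ 3) (PowerSeries.X ^ 5)) ∧
      RogersEquations (sumG (PowerSeries.X : PowerSeries R)) (sumH PowerSeries.X) ∧
      RogersEquations (prodG (PowerSeries.X : PowerSeries R)) (prodH PowerSeries.X) ∧
      (PowerSeries.constantCoeff (sumG (PowerSeries.X : PowerSeries R)) = 1 ∧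
        PowerSeries.constantCoeff (sumH (PowerSeries.X : PowerSeries R)) = 1 ∧
        PowerSeries.constantCoeff (prodG (PowerSeries.X : PowerSeries R)) = 1 ∧
        PowerSeries.constantCoeff (prodH (PowerSeries.X : PowerSeries R)) = 1) ∧
      -- Rogers' equations and the initial values determine the pair of power series
      (∀ G H G' H' : PowerSeries R,
        RogersEquations G H → PowerSeries.constantCoeff G = 1 → PowerSeries.constantCoeff H = 1 →
        RogersEquations G' H' → PowerSeries.constantCoeff G' = 1 →
        PowerSeries.constantCoeff H' = 1 → G = G' ∧ H = H')) := by
  refine ⟨fun q hq => ⟨converges hq, sumG_eq_prodG hq, sumH_eq_prodH hq, ?_, ?_,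
    rogersEquationsAt_sum hq, rogersEquationsAt_prod hq⟩, ⟨sumG_zero, sumH_zero, ?_, ?_⟩,
    fun R _ _ _ => ⟨?_, sumG_X_eq_prodG R, sumH_X_eq_prodH R, ?_, ?_, rogersEquations_sum R, ?_,
      ⟨constantCoeff_sumG_X R, constantCoeff_sumH_X R, ?_, ?_⟩, ?_⟩⟩
  · rw [sumG_eq hq, Ring.inverse_eq_inv]
  · rw [sumH_eq hq, Ring.inverse_eq_inv]
  · rw [← sumG_eq_prodG (by simp), sumG_zero]
  · rw [← sumH_eq_prodH (by simp), sumH_zero]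
  · rw [← IntSeries.toSeries_X]
    exact converges_map (IntSeries.continuous_toSeries R) IntSeries.norm_X_lt_one
  · have h := toSeries_inverse_mul R one_ne_zero four_ne_zero
    rw [pow_one, pow_one] at h
    rw [sumG_X, sumG_eq IntSeries.norm_X_lt_one, h]
  · rw [sumH_X, sumH_eq IntSeries.norm_X_lt_one, toSeries_inverse_mul R two_ne_zero three_ne_zero]
  · rw [← sumG_X_eq_prodG, ← sumH_X_eq_prodH]
    exact rogersEquations_sum R
  · rw [← sumG_X_eq_prodG, constantCoeff_sumG_X]
  · rw [← sumH_X_eq_prodH, constantCoeff_sumH_X]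
  · intro G H G' H' h hG hH h' hG' hH'
    exact h.unique h' (hG.trans hG'.symm) (hH.trans hH'.symm)
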